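/- Let $\mathbb{K}$ be a field, $n$ a natural number, $m_1,\dots,m_n$ integers, and $\mathbf{k}_n=\bigoplus_{i=1}^n \mathbb{K}e_i$ with $e_i$ orthogonal idempotents. Let $\mathscr{I}_n$ be the DG-algebra over $\mathbf{k}_n$ (the total algebra of a DG-category with $n$ objects; products are read from right to left) freely generated by morphisms $c^0_{ij}$ ($1\le i<j\le n$) and $c^p_{ij}$ ($p\ge 1$, $1\le i,j\le n$) from the $i$-th to the $j$-th object, i.e. $e_jc^p_{ij}e_i=c^p_{ij}$, with cohomological grading $|c^p_{ij}|=1-2p+m_j-m_i$, and with the differential determined by the graded Leibniz rule $\partial(a_2a_1)=\partial(a_2)a_1+(-1)^{|a_2|}a_2\,\partial(a_1)$ and $$\partial c^0_{ij}=\sum_{i<r<j}(-1)^{m_r+m_j}c^0_{rj}c^0_{ir},\qquad \partial c^1_{ij}=\delta_{ij}e_i+\sum_{r>i}(-1)^{m_r+m_j}c^1_{rj}c^0_{ir}+\sum_{r<j}(-1)^{m_r+m_j}c^0_{rj}c^1_{ir},$$ $$\partial c^p_{ij}=\sum_{0\le q\le p}\ \sum_{r=1}^n(-1)^{m_r+m_j}c^{p-q}_{rj}c^q_{ir}\qquad(p>1),$$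 where $c^0_{ij}=0$ for $i\ge j$. Let $\mathscr{A}_n\subset\mathscr{I}_n$ be the DG-subalgebra generated over $\mathbf{k}_n$ by the $c^0_{ij}$ ($i<j$) and the $c^1_{ij}$. Theorem. There is a map $\mathfrak{r}:\mathscr{I}_n\to\mathscr{A}_n$ of DG-algebras over $\mathbf{k}_n$ such that $\mathfrak{r}|_{\mathscr{A}_n}=\mathrm{Id}_{\mathscr{A}_n}$, such that for all $p>1$ and $1\le i,j\le n$ $$\mathfrak{r}(c^p_{ij})=C_{p-1}\sum_{k_1,\dots,k_{2p-2}=1}^n(-1)^{m_{k_1}+\dots+m_{k_{2p-2}}}\;c^1_{k_{2p-2}\,j}\cdots c^1_{k_1k_2}\,c^1_{i\,k_1},$$ where $C_p=\frac{1}{p+1}\binom{2p}{p}$ is the $p$-th Catalan number, and such that $\mathfrak{r}$ is a quasi-isomorphism. -/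

import Mathlib

open CategoryTheory

universe u

/-- The sign `(-1)^k`. -/
def sg (k : ℤ) : ℤ := (k.negOnePow : ℤ)

theorem sg_zero : sg 0 = 1 := by simp [sg]

theorem sg_add (k l : ℤ) : sg (k + l) = sg k * sg l := by simp [sg, Int.negOnePow_add]

theorem sg_mul_self (k : ℤ) : sg k * sg k = 1 := by
  have h : ((k.negOnePow * k.negOnePow : ℤˣ) : ℤ) = 1 := by rw [Int.units_mul_self, Units.val_one]
  simpa only [sg, Units.val_mul] using h

theorem sg_one : sg 1 = -1 := by simp [sg]

/-! ## DG-algebras over a ring `k` (itself a commutative algebra over a field `K`) -/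

/-- A (cohomologically graded) DG-algebra over `k`: a `ℤ`-graded `K`-algebra with a map from `k`
to its degree zero part (whose image need not be central), with a differential of degree `+1`
which vanishes on `k` and satisfies the graded Leibniz rule. -/
structure DGAlg (K : Type u) [Field K] (k : Type u) [CommRing k] [Algebra K k] where
  carrier : Type u
  [ring : Ring carrier]
  [algebra : Algebra K carrier]
  unit : k →ₐ[K] carrier
  gr : ℤ → Submodule K carrier
  gr_internal : DirectSum.IsInternal gr
  unit_mem : ∀ x, unit x ∈ gr 0
  mul_mem : ∀ {i j : ℤ} {a b : carrier}, a ∈ gr i → b ∈ gr j → a * b ∈ gr (i + j)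
  d : carrier →ₗ[K] carrier
  d_mem : ∀ {i : ℤ} {a : carrier}, a ∈ gr i → d a ∈ gr (i + 1)
  d_unit : ∀ x, d (unit x) = 0
  leibniz : ∀ {i : ℤ} {a b : carrier}, a ∈ gr i → d (a * b) = d a * b + sg i • (a * d b)
  d_d : ∀ a, d (d a) = 0

namespace DGAlg

attribute [instance] DGAlg.ring DGAlg.algebra

variable {K : Type u} [Field K] {k : Type u} [CommRing k] [Algebra K k]

/-- Maps of DG-algebras over `k`. -/
structure Hom (A B : DGAlg K k) where
  toAlgHom : A.carrier →ₐ[K] B.carrier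
  map_unit : ∀ x, toAlgHom (A.unit x) = B.unit x
  map_mem : ∀ {i : ℤ} {a : A.carrier}, a ∈ A.gr i → toAlgHom a ∈ B.gr i
  map_d : ∀ a, toAlgHom (A.d a) = B.d (toAlgHom a)

/-- The underlying cochain complex of `K`-vector spaces. -/
noncomputable def complex (A : DGAlg K k) : CochainComplex (ModuleCat.{u} K) ℤ where
  X i := ModuleCat.of K (A.gr i)
  d i j := if h : i + 1 = j then
      ModuleCat.ofHom (A.d.restrict (p := A.gr i) (q := A.gr j) fun _ ha => h ▸ A.d_mem ha)
    else 0
  shape i j h := dif_neg h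
  d_comp_d' i j l hij hjl := by
    change i + 1 = j at hij
    change j + 1 = l at hjl
    rw [dif_pos hij, dif_pos hjl]
    ext a
    exact A.d_d _

/-- The map of cochain complexes underlying a map of DG-algebras. -/
noncomputable def Hom.chainMap {A B : DGAlg K k} (f : Hom A B) : A.complex ⟶ B.complex where
  f i := ModuleCat.ofHom
    (f.toAlgHom.toLinearMap.restrict (p := A.gr i) (q := B.gr i) fun _ ha => f.map_mem ha)
  comm' i j hij := by
    change i + 1 = j at hij
    simp only [complex, dif_pos hij]
    ext a
    change B.d (f.toAlgHom _) = f.toAlgHom (A.d _)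
    exact (f.map_d _).symm

/-- The DG-subalgebra over `k` with a given underlying subalgebra `S`, which has to be homogeneous
and closed under the differential and has to contain the image of `k`. -/
noncomputable def sub (A : DGAlg K k) (S : Subalgebra K A.carrier) (h_unit : ∀ x, A.unit x ∈ S)
    (h_d : ∀ a ∈ S, A.d a ∈ S)
    (h_gr : ⨆ i, (A.gr i).comap S.val.toLinearMap = ⊤) : DGAlg K k where
  carrier := S
  unit := A.unit.codRestrict S h_unit
  gr i := (A.gr i).comap S.val.toLinearMap
  gr_internal := by
    rw [DirectSum.isInternal_submodule_iff_iSupIndep_and_iSup_eq_top]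
    refine ⟨fun i => ?_, h_gr⟩
    have hA := ((DirectSum.isInternal_submodule_iff_iSupIndep_and_iSup_eq_top _).1
      A.gr_internal).1 i
    rw [Submodule.disjoint_def] at hA ⊢
    intro x hx hx'
    refine Subtype.ext (hA x hx ?_)
    have h1 : (x : A.carrier) ∈ (⨆ j, ⨆ (_ : j ≠ i),
        (A.gr j).comap S.val.toLinearMap).map S.val.toLinearMap := ⟨x, hx', rfl⟩
    simp only [Submodule.map_iSup] at h1
    exact (iSup₂_mono fun j _ => Submodule.map_comap_le _ _ :
      (⨆ j, ⨆ (_ : j ≠ i), ((A.gr j).comap S.val.toLinearMap).map S.val.toLinearMap) ≤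
        ⨆ j, ⨆ (_ : j ≠ i), A.gr j) h1
  unit_mem x := A.unit_mem x
  mul_mem ha hb := A.mul_mem ha hb
  d := A.d.restrict (p := Subalgebra.toSubmodule S) (q := Subalgebra.toSubmodule S) h_d
  d_mem ha := A.d_mem ha
  d_unit x := Subtype.ext (A.d_unit x)
  leibniz ha := Subtype.ext (A.leibniz ha)
  d_d a := Subtype.ext (A.d_d a)

/-- The inclusion of a DG-subalgebra. -/
noncomputable def subIncl (A : DGAlg K k) (S : Subalgebra K A.carrier)
    (h_unit : ∀ x, A.unit x ∈ S) (h_d : ∀ a ∈ S, A.d a ∈ S)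
    (h_gr : ⨆ i, (A.gr i).comap S.val.toLinearMap = ⊤) : Hom (A.sub S h_unit h_d h_gr) A where
  toAlgHom := S.val
  map_unit _ := rfl
  map_mem ha := ha
  map_d _ := rfl

end DGAlg

/-! ## The internal DG-algebra -/

namespace Internal

/-- The symbols `e_i` and `c^p_{ij}`. -/
inductive Symbol (n : ℕ) : Type
  | e (i : Fin n) : Symbol n
  | c (p : ℕ) (i j : Fin n) : Symbol n

/-- The relations saying that the `e_i` are orthogonal idempotents with sum `1`, that `c^p_{ij}`
is a morphism from the `i`-th to the `j`-th object (products are read from right to left), and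
that `c^0_{ij}` is zero for `i ≥ j`. -/
inductive Rel (K : Type u) [Field K] (n : ℕ) :
    FreeAlgebra K (Symbol n) → FreeAlgebra K (Symbol n) → Prop
  | idem (i : Fin n) :
      Rel K n (FreeAlgebra.ι K (.e i) * FreeAlgebra.ι K (.e i)) (FreeAlgebra.ι K (.e i))
  | orth (i j : Fin n) (h : i ≠ j) :
      Rel K n (FreeAlgebra.ι K (.e i) * FreeAlgebra.ι K (.e j)) 0
  | sum : Rel K n (∑ i, FreeAlgebra.ι K (.e i)) 1
  | target (p : ℕ) (i j : Fin n) :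
      Rel K n (FreeAlgebra.ι K (.e j) * FreeAlgebra.ι K (.c p i j)) (FreeAlgebra.ι K (.c p i j))
  | source (p : ℕ) (i j : Fin n) :
      Rel K n (FreeAlgebra.ι K (.c p i j) * FreeAlgebra.ι K (.e i)) (FreeAlgebra.ι K (.c p i j))
  | zero (i j : Fin n) (h : j ≤ i) : Rel K n (FreeAlgebra.ι K (.c 0 i j)) 0

/-- The total algebra of the `K`-linear category with `n` objects freely generated by morphisms
`c^0_{ij}` for `i < j` and `c^p_{ij}` for `p ≥ 1` and all `i, j`, from the `i`-th to the `j`-th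
object. -/
def Alg (K : Type u) [Field K] (n : ℕ) : Type u := RingQuot (Rel K n)

noncomputable instance (K : Type u) [Field K] (n : ℕ) : Ring (Alg K n) :=
  inferInstanceAs (Ring (RingQuot (Rel K n)))

noncomputable instance (K : Type u) [Field K] (n : ℕ) : Algebra K (Alg K n) :=
  inferInstanceAs (Algebra K (RingQuot (Rel K n)))

/-- The quotient map from the free algebra on the symbols. -/
noncomputable def mk (K : Type u) [Field K] (n : ℕ) : FreeAlgebra K (Symbol n) →ₐ[K] Alg K n :=
  RingQuot.mkAlgHom K (Rel K n)

theorem mk_rel {K : Type u} [Field K] {n : ℕ} {x y : FreeAlgebra K (Symbol n)}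
    (h : Rel K n x y) : mk K n x = mk K n y :=
  RingQuot.mkAlgHom_rel K h

section

variable (K : Type u) [Field K] {n : ℕ}

/-- The element of the algebra given by a symbol. -/
noncomputable def gen (s : Symbol n) : Alg K n :=
  mk K n (FreeAlgebra.ι K s)

/-- The idempotent `e_i`. -/
noncomputable def e (i : Fin n) : Alg K n := gen K (.e i)

/-- The generator `c^p_{ij}`; it is zero if `p = 0` and `i ≥ j`. -/
noncomputable def c (p : ℕ) (i j : Fin n) : Alg K n := gen K (.c p i j)

theorem gen_e (i : Fin n) : gen K (.e i) = e K i := rfl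

theorem gen_c (p : ℕ) (i j : Fin n) : gen K (.c p i j) = c K p i j := rfl

theorem e_mul_self (i : Fin n) : e K i * e K i = e K i := by
  simpa [e, gen] using mk_rel (Rel.idem (K := K) i)

theorem e_mul_e {i j : Fin n} (h : i ≠ j) : e K i * e K j = 0 := by
  simpa [e, gen] using mk_rel (Rel.orth (K := K) i j h)

theorem sum_e : ∑ i : Fin n, e K i = 1 := by
  simpa [e, gen] using mk_rel (Rel.sum (K := K) (n := n))

theorem e_mul_c (p : ℕ) (i j : Fin n) : e K j * c K p i j = c K p i j := by
  simpa [e, c, gen] using mk_rel (Rel.target (K := K) p i j)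

theorem c_mul_e (p : ℕ) (i j : Fin n) : c K p i j * e K i = c K p i j := by
  simpa [e, c, gen] using mk_rel (Rel.source (K := K) p i j)

theorem c_zero {i j : Fin n} (h : j ≤ i) : c K 0 i j = 0 := by
  simpa [c, gen] using mk_rel (Rel.zero (K := K) i j h)

variable {K}

theorem lift_rel {B : Type*} [Ring B] [Algebra K B] (f : Symbol n → B)
    (h_idem : ∀ i, f (.e i) * f (.e i) = f (.e i))
    (h_orth : ∀ i j, i ≠ j → f (.e i) * f (.e j) = 0)
    (h_sum : ∑ i, f (.e i) = 1)
    (h_target : ∀ p i j, f (.e j) * f (.c p i j) = f (.c p i j))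
    (h_source : ∀ p i j, f (.c p i j) * f (.e i) = f (.c p i j))
    (h_zero : ∀ i j, j ≤ i → f (.c 0 i j) = 0) ⦃x y : FreeAlgebra K (Symbol n)⦄
    (h : Rel K n x y) : FreeAlgebra.lift K f x = FreeAlgebra.lift K f y := by
  induction h with
  | idem i => simpa using h_idem i
  | orth i j h => simpa using h_orth i j h
  | sum => simpa using h_sum
  | target p i j => simpa using h_target p i j
  | source p i j => simpa using h_source p i j
  | zero i j h => simpa using h_zero i j h

/-- The universal property of the algebra. -/
noncomputable def lift {B : Type*} [Ring B] [Algebra K B] (f : Symbol n → B)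
    (h_idem : ∀ i, f (.e i) * f (.e i) = f (.e i))
    (h_orth : ∀ i j, i ≠ j → f (.e i) * f (.e j) = 0)
    (h_sum : ∑ i, f (.e i) = 1)
    (h_target : ∀ p i j, f (.e j) * f (.c p i j) = f (.c p i j))
    (h_source : ∀ p i j, f (.c p i j) * f (.e i) = f (.c p i j))
    (h_zero : ∀ i j, j ≤ i → f (.c 0 i j) = 0) : Alg K n →ₐ[K] B :=
  RingQuot.liftAlgHom K
    ⟨FreeAlgebra.lift K f, lift_rel f h_idem h_orth h_sum h_target h_source h_zero⟩

theorem lift_gen {B : Type*} [Ring B] [Algebra K B] (f : Symbol n → B)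
    (h1 h2 h3 h4 h5 h6) (s : Symbol n) : lift (K := K) f h1 h2 h3 h4 h5 h6 (gen K s) = f s :=
  (RingQuot.liftAlgHom_mkAlgHom_apply K (FreeAlgebra.lift K f)
    (lift_rel f h1 h2 h3 h4 h5 h6) (FreeAlgebra.ι K s)).trans (FreeAlgebra.lift_ι_apply f s)

theorem induction_gen {P : Alg K n → Prop} (hK : ∀ x : K, P (algebraMap K _ x))
    (hgen : ∀ s, P (gen K s)) (hmul : ∀ a b, P a → P b → P (a * b))
    (hadd : ∀ a b, P a → P b → P (a + b)) (a : Alg K n) : P a := by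
  obtain ⟨a, rfl⟩ : ∃ b, mk K n b = a := RingQuot.mkAlgHom_surjective K (Rel K n) a
  induction a using FreeAlgebra.induction with
  | grade0 r => simpa using hK r
  | grade1 s => exact hgen s
  | mul a b ha hb => rw [map_mul]; exact hmul _ _ ha hb
  | add a b ha hb => rw [map_add]; exact hadd _ _ ha hb

theorem algHom_ext_gen {B : Type*} [Ring B] [Algebra K B] {f g : Alg K n →ₐ[K] B}
    (h : ∀ s, f (gen K s) = g (gen K s)) : f = g := by
  refine AlgHom.ext fun a => ?_
  induction a using induction_gen with
  | hK x => simp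
  | hgen s => exact h s
  | hmul a b ha hb => rw [map_mul, map_mul, ha, hb]
  | hadd a b ha hb => rw [map_add, map_add, ha, hb]

variable (K n) in
/-- The map from `⨁ K e_i` to the algebra. -/
noncomputable def unit : (Fin n → K) →ₐ[K] Alg K n :=
  AlgHom.ofLinearMap (∑ i, (LinearMap.proj i : (Fin n → K) →ₗ[K] K).smulRight (e K i))
    (by simp [sum_e])
    (by
      intro x y
      simp only [LinearMap.sum_apply, LinearMap.smulRight_apply, LinearMap.proj_apply,
        Pi.mul_apply, Finset.sum_mul_sum]
      refine Finset.sum_congr rfl fun i _ => ?_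
      rw [Finset.sum_eq_single i]
      · rw [smul_mul_smul_comm, e_mul_self]
      · intro j _ hj
        rw [smul_mul_smul_comm, e_mul_e K hj.symm, smul_zero]
      · simp)

theorem unit_apply (x : Fin n → K) : unit K n x = ∑ i, x i • e K i := by
  simp [unit]

end

/-! ### Grading -/

/-- The degree of the symbols: `|e_i| = 0` and `|c^p_{ij}| = 1 - 2p + m_j - m_i`. -/
def deg {n : ℕ} (m : Fin n → ℤ) : Symbol n → ℤ
  | .e _ => 0
  | .c p i j => 1 - 2 * p + m j - m i

section

variable (K : Type u) [Field K] {n : ℕ} (m : Fin n → ℤ)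

/-- The degree `k` part: the span of the words of total degree `k`. -/
noncomputable def gr (k : ℤ) : Submodule K (Alg K n) :=
  Submodule.span K
    {x | ∃ l : List (Symbol n), (l.map (deg m)).sum = k ∧ (l.map (gen K)).prod = x}

/-! ### Differential -/

/-- The differential of `c^p_{ij}`. As `c^0_{ij} = 0` for `i ≥ j`, this formula covers
`p = 0`, `p = 1` and `p > 1` at once. -/
noncomputable def dc (p : ℕ) (i j : Fin n) : Alg K n :=
  (if p = 1 ∧ i = j then e K i else 0) +
    ∑ q ∈ Finset.range (p + 1), ∑ r : Fin n,
      sg (m r + m j) • (c K (p - q) r j * c K q i r)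

/-- The differential of the symbols. -/
noncomputable def dgen : Symbol n → Alg K n
  | .e _ => 0
  | .c p i j => dc K m p i j

theorem dc_zero {i j : Fin n} (h : j ≤ i) : dc K m 0 i j = 0 := by
  simp only [dc, zero_ne_one, false_and, if_false, zero_add, Finset.range_one,
    Finset.sum_singleton, Nat.sub_zero]
  refine Finset.sum_eq_zero fun r _ => ?_
  rcases le_or_gt r i with hr | hr
  · rw [c_zero K hr, mul_zero, smul_zero]
  · rw [c_zero K (h.trans hr.le), zero_mul, smul_zero]

theorem e_mul_dc (p : ℕ) (i j : Fin n) : e K j * dc K m p i j = dc K m p i j := by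
  simp only [dc, mul_add, Finset.mul_sum]
  congr 1
  · split_ifs with h
    · rw [h.2, e_mul_self]
    · rw [mul_zero]
  · refine Finset.sum_congr rfl fun q _ => Finset.sum_congr rfl fun r _ => ?_
    rw [mul_smul_comm, ← mul_assoc, e_mul_c]

theorem dc_mul_e (p : ℕ) (i j : Fin n) : dc K m p i j * e K i = dc K m p i j := by
  simp only [dc, add_mul, Finset.sum_mul]
  congr 1
  · split_ifs with h
    · rw [e_mul_self]
    · rw [zero_mul]
  · refine Finset.sum_congr rfl fun q _ => Finset.sum_congr rfl fun r _ => ?_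
    rw [smul_mul_assoc, mul_assoc, c_mul_e]

/-- The algebra map `a ↦ (-1)^{|a|} a`. -/
noncomputable def sgn : Alg K n →ₐ[K] Alg K n :=
  lift (fun s => sg (deg m s) • gen K s)
    (by simp [-zsmul_eq_mul, sg_zero, deg, gen_e, e_mul_self])
    (by intro i j h; simp [-zsmul_eq_mul, sg_zero, deg, gen_e, e_mul_e K h])
    (by simp [-zsmul_eq_mul, sg_zero, deg, gen_e, sum_e])
    (by intro p i j; simp [-zsmul_eq_mul, sg_zero, deg, gen_e, gen_c, e_mul_c])
    (by intro p i j; simp [-zsmul_eq_mul, sg_zero, deg, gen_e, gen_c, c_mul_e])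
    (by intro i j h; simp [gen_c, c_zero K h])

theorem sgn_gen (s : Symbol n) : sgn K m (gen K s) = sg (deg m s) • gen K s :=
  lift_gen _ _ _ _ _ _ _ s

/-- The algebra map `a ↦ [(-1)^{|a|} a, ∂a; 0, a]`. Its multiplicativity is the graded Leibniz
rule for `∂`. -/
noncomputable def dMat : Alg K n →ₐ[K] Matrix (Fin 2) (Fin 2) (Alg K n) :=
  lift (fun s => !![sg (deg m s) • gen K s, dgen K m s; 0, gen K s])
    (by intro i; simp [-zsmul_eq_mul, sg_zero, deg, dgen, gen_e, e_mul_self])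
    (by
      intro i j h
      ext a b
      fin_cases a <;> fin_cases b <;> simp [-zsmul_eq_mul, sg_zero, deg, dgen, gen_e, e_mul_e K h])
    (by
      ext a b
      fin_cases a <;> fin_cases b <;> simp [-zsmul_eq_mul, Matrix.sum_apply, sg_zero, deg, dgen, gen_e, sum_e])
    (by
      intro p i j
      simp [-zsmul_eq_mul, sg_zero, deg, dgen, gen_e, gen_c, e_mul_c, e_mul_dc])
    (by
      intro p i j
      simp [-zsmul_eq_mul, sg_zero, deg, dgen, gen_e, gen_c, c_mul_e, dc_mul_e])
    (by
      intro i j h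
      ext a b
      fin_cases a <;> fin_cases b <;> simp [-zsmul_eq_mul, dgen, gen_c, c_zero K h, dc_zero K m h])

theorem dMat_gen (s : Symbol n) :
    dMat K m (gen K s) = !![sg (deg m s) • gen K s, dgen K m s; 0, gen K s] :=
  lift_gen _ _ _ _ _ _ _ s

/-- The differential: the linear map determined by its values on the generators and by the
graded Leibniz rule. -/
noncomputable def d : Alg K n →ₗ[K] Alg K n where
  toFun a := dMat K m a 0 1
  map_add' a b := by simp
  map_smul' x a := by simp

theorem d_gen (s : Symbol n) : d K m (gen K s) = dgen K m s := by
  change dMat K m (gen K s) 0 1 = _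
  rw [dMat_gen]
  rfl

theorem dMat_eq (a : Alg K n) : dMat K m a = !![sgn K m a, d K m a; 0, a] := by
  induction a using induction_gen with
  | hK x =>
    ext i j
    fin_cases i <;> fin_cases j <;> simp [d, Matrix.algebraMap_matrix_apply]
  | hgen s => rw [dMat_gen, sgn_gen, d_gen]
  | hmul a b ha hb =>
    have h : d K m (a * b) = (dMat K m a * dMat K m b) 0 1 := by rw [← map_mul]; rfl
    rw [h, map_mul, ha, hb]
    ext i j
    fin_cases i <;> fin_cases j <;> simp
  | hadd a b ha hb =>
    rw [map_add, ha, hb]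
    ext i j
    fin_cases i <;> fin_cases j <;> simp

theorem d_mul (a b : Alg K n) : d K m (a * b) = d K m a * b + sgn K m a * d K m b := by
  have h : d K m (a * b) = (dMat K m a * dMat K m b) 0 1 := by rw [← map_mul]; rfl
  rw [h, dMat_eq, dMat_eq]
  simp [add_comm]

theorem d_e (i : Fin n) : d K m (e K i) = 0 := d_gen K m (.e i)

theorem d_c (p : ℕ) (i j : Fin n) : d K m (c K p i j) = dc K m p i j := d_gen K m (.c p i j)

theorem d_unit (x : Fin n → K) : d K m (unit K n x) = 0 := by
  simp [unit_apply, d_e]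

theorem d_algebraMap (x : K) : d K m (algebraMap K _ x) = 0 := by
  rw [← (unit K n).commutes x]
  exact d_unit K m _

theorem gen_mem (s : Symbol n) : gen K s ∈ gr K m (deg m s) :=
  Submodule.subset_span ⟨[s], by simp, by simp⟩

theorem one_mem_gr : (1 : Alg K n) ∈ gr K m 0 := Submodule.subset_span ⟨[], by simp, by simp⟩

theorem mul_mem_gr {k l : ℤ} {a b : Alg K n} (ha : a ∈ gr K m k) (hb : b ∈ gr K m l) :
    a * b ∈ gr K m (k + l) := by
  have h := Submodule.mul_mem_mul ha hb
  rw [gr, gr, Submodule.span_mul_span] at h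
  refine Submodule.span_mono ?_ h
  rintro _ ⟨_, ⟨l1, rfl, rfl⟩, _, ⟨l2, rfl, rfl⟩, rfl⟩
  exact ⟨l1 ++ l2, by simp, by simp⟩

theorem unit_mem_gr (x : Fin n → K) : unit K n x ∈ gr K m 0 := by
  rw [unit_apply]
  exact Submodule.sum_mem _ fun i _ => Submodule.smul_mem _ _ (gen_mem K m (.e i))

theorem sgn_of_mem {k : ℤ} {a : Alg K n} (ha : a ∈ gr K m k) : sgn K m a = sg k • a := by
  induction ha using Submodule.span_induction with
  | mem x hx =>
    obtain ⟨l, rfl, rfl⟩ := hx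
    induction l with
    | nil => simp [sg_zero]
    | cons s l ih =>
      simp only [List.map_cons, List.prod_cons, List.sum_cons, map_mul, ih, sgn_gen, sg_add,
        smul_mul_smul_comm]
  | zero => rw [map_zero, smul_zero]
  | add x y _ _ hx hy => rw [map_add, hx, hy, smul_add]
  | smul t x _ hx => rw [map_smul, hx, smul_comm]

theorem c_mem (p : ℕ) (i j : Fin n) : c K p i j ∈ gr K m (1 - 2 * p + m j - m i) :=
  gen_mem K m (.c p i j)

theorem dc_mem (p : ℕ) (i j : Fin n) : dc K m p i j ∈ gr K m (1 - 2 * p + m j - m i + 1) := by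
  refine Submodule.add_mem _ ?_ (Submodule.sum_mem _ fun q hq => Submodule.sum_mem _ fun r _ => ?_)
  · split_ifs with h
    · obtain ⟨rfl, rfl⟩ := h
      have h0 : (1 - 2 * ((1 : ℕ) : ℤ) + m i - m i + 1) = deg m (.e i) := by
        simp only [deg]
        push_cast
        ring
      rw [h0]
      exact gen_mem K m (.e i)
    · exact Submodule.zero_mem _
  · refine zsmul_mem ?_ _
    have h := mul_mem_gr K m (c_mem K m (p - q) r j) (c_mem K m q i r)
    have hq' : q ≤ p := Nat.lt_succ_iff.1 (Finset.mem_range.1 hq)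
    convert h using 2
    rw [Nat.cast_sub hq']
    ring

theorem dgen_mem (s : Symbol n) : dgen K m s ∈ gr K m (deg m s + 1) := by
  cases s with
  | e i => exact Submodule.zero_mem _
  | c p i j => exact dc_mem K m p i j

theorem d_mem_gr {k : ℤ} {a : Alg K n} (ha : a ∈ gr K m k) : d K m a ∈ gr K m (k + 1) := by
  induction ha using Submodule.span_induction with
  | mem x hx =>
    obtain ⟨l, rfl, rfl⟩ := hx
    induction l with
    | nil =>
      have h : d K m 1 = 0 := by simpa using d_algebraMap K m 1
      simp [h]
    | cons s l ih =>
      simp only [List.map_cons, List.prod_cons, List.sum_cons, d_mul, d_gen, sgn_gen]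
      refine Submodule.add_mem _ ?_ ?_
      · have h := mul_mem_gr K m (dgen_mem K m s)
          (Submodule.subset_span ⟨l, rfl, rfl⟩ : (l.map (gen K)).prod ∈ gr K m _)
        convert h using 2
        ring
      · rw [smul_mul_assoc]
        refine zsmul_mem ?_ _
        have h := mul_mem_gr K m (gen_mem K m s) ih
        convert h using 2
        ring
  | zero => simp
  | add x y _ _ hx hy => rw [map_add]; exact Submodule.add_mem _ hx hy
  | smul t x _ hx => rw [map_smul]; exact Submodule.smul_mem _ _ hx

theorem leibniz_gr {k : ℤ} {a b : Alg K n} (ha : a ∈ gr K m k) :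
    d K m (a * b) = d K m a * b + sg k • (a * d K m b) := by
  rw [d_mul, sgn_of_mem K m ha, smul_mul_assoc]

/-- The algebra map multiplying a homogeneous element of degree `k` by the `k`-th power of the
variable. -/
noncomputable def weight : Alg K n →ₐ[K] AddMonoidAlgebra (Alg K n) ℤ :=
  lift (fun s => AddMonoidAlgebra.single (deg m s) (gen K s))
    (by
      intro i
      simp only [AddMonoidAlgebra.single_mul_single, deg, gen_e, e_mul_self, add_zero])
    (by
      intro i j h
      simp only [AddMonoidAlgebra.single_mul_single, deg, gen_e, e_mul_e K h,
        AddMonoidAlgebra.single_zero])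
    (by
      simp only [deg, gen_e, AddMonoidAlgebra.one_def]
      rw [← sum_e K]
      exact (map_sum (AddMonoidAlgebra.singleAddHom (0 : ℤ)) _ _).symm)
    (by
      intro p i j
      simp only [AddMonoidAlgebra.single_mul_single, deg, gen_e, gen_c, e_mul_c, zero_add])
    (by
      intro p i j
      simp only [AddMonoidAlgebra.single_mul_single, deg, gen_e, gen_c, c_mul_e, add_zero])
    (by
      intro i j h
      simp only [gen_c, c_zero K h, AddMonoidAlgebra.single_zero])

theorem weight_of_mem {k : ℤ} {a : Alg K n} (ha : a ∈ gr K m k) :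
    weight K m a = AddMonoidAlgebra.single k a := by
  induction ha using Submodule.span_induction with
  | mem x hx =>
    obtain ⟨l, rfl, rfl⟩ := hx
    induction l with
    | nil =>
      simp only [List.map_nil, List.prod_nil, List.sum_nil, map_one, AddMonoidAlgebra.one_def]
    | cons s l ih =>
      have h : weight K m (gen K s) = AddMonoidAlgebra.single (deg m s) (gen K s) :=
        lift_gen _ _ _ _ _ _ _ s
      simp only [List.map_cons, List.prod_cons, List.sum_cons, map_mul, ih, h,
        AddMonoidAlgebra.single_mul_single]
  | zero => rw [map_zero, AddMonoidAlgebra.single_zero]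
  | add x y _ _ hx hy => rw [map_add, hx, hy, AddMonoidAlgebra.single_add]
  | smul t x _ hx => rw [map_smul, hx, AddMonoidAlgebra.smul_single]

theorem gr_iSupIndep : iSupIndep (gr K m) := by
  intro i
  rw [Submodule.disjoint_def]
  intro x hx hx'
  let N : Submodule K (Alg K n) :=
    { carrier := {a | (weight K m a).coeff i = 0}
      add_mem' := by
        intro a b ha hb
        simp only [Set.mem_ofPred_eq] at *
        rw [map_add, AddMonoidAlgebra.coeff_add, Finsupp.add_apply, ha, hb, add_zero]
      zero_mem' := by simp
      smul_mem' := by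
        intro t a ha
        simp only [Set.mem_ofPred_eq] at *
        rw [map_smul, AddMonoidAlgebra.coeff_smul_apply, ha, smul_zero] }
  have hN : (⨆ j, ⨆ (_ : j ≠ i), gr K m j) ≤ N := by
    refine iSup₂_le fun j hj a ha => ?_
    change (weight K m a).coeff i = 0
    rw [weight_of_mem K m ha, AddMonoidAlgebra.coeff_single, Finsupp.single_apply, if_neg hj]
  have h : (weight K m x).coeff i = 0 := hN hx'
  rw [weight_of_mem K m hx, AddMonoidAlgebra.coeff_single, Finsupp.single_apply, if_pos rfl] at h
  exact h

theorem word_adjoin_le (S : Set (Alg K n)) (hS : ∀ x ∈ S, ∃ k, x ∈ gr K m k) :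
    Subalgebra.toSubmodule (Algebra.adjoin K S) ≤
      ⨆ k, gr K m k ⊓ Subalgebra.toSubmodule (Algebra.adjoin K S) := by
  have key : ∀ x ∈ Submonoid.closure S,
      ∃ k, x ∈ gr K m k ⊓ Subalgebra.toSubmodule (Algebra.adjoin K S) := by
    intro x hx
    induction hx using Submonoid.closure_induction with
    | mem x hx => exact (hS x hx).imp fun k hk => ⟨hk, Algebra.subset_adjoin hx⟩
    | one => exact ⟨0, one_mem_gr K m, Subalgebra.one_mem _⟩
    | mul x y _ _ hx hy =>
      obtain ⟨k, hk⟩ := hx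
      obtain ⟨l, hl⟩ := hy
      exact ⟨k + l, mul_mem_gr K m hk.1 hl.1, Subalgebra.mul_mem _ hk.2 hl.2⟩
  conv_lhs => rw [Algebra.adjoin_eq_span]
  rw [Submodule.span_le]
  intro x hx
  obtain ⟨k, hk⟩ := key x hx
  exact Submodule.mem_iSup_of_mem k hk

theorem adjoin_gen : Algebra.adjoin K (Set.range (gen K : Symbol n → Alg K n)) = ⊤ := by
  refine eq_top_iff.2 fun a _ => ?_
  induction a using induction_gen with
  | hK x => exact Subalgebra.algebraMap_mem _ x
  | hgen s => exact Algebra.subset_adjoin ⟨s, rfl⟩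
  | hmul a b ha hb => exact Subalgebra.mul_mem _ (ha trivial) (hb trivial)
  | hadd a b ha hb => exact Subalgebra.add_mem _ (ha trivial) (hb trivial)

theorem gr_internal : DirectSum.IsInternal (gr K m) := by
  rw [DirectSum.isInternal_submodule_iff_iSupIndep_and_iSup_eq_top]
  refine ⟨gr_iSupIndep K m, eq_top_iff.2 ?_⟩
  have h := word_adjoin_le K m (Set.range (gen K)) (by
    rintro _ ⟨s, rfl⟩
    exact ⟨_, gen_mem K m s⟩)
  rw [adjoin_gen, Algebra.top_toSubmodule] at h
  exact h.trans (iSup_mono fun k => inf_le_left)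

theorem sgn_d_gen (s : Symbol n) : sgn K m (dgen K m s) = - (sg (deg m s) • dgen K m s) := by
  rw [sgn_of_mem K m (dgen_mem K m s), sg_add, sg_one, mul_neg, mul_one, neg_smul]

theorem sgn_d (a : Alg K n) : sgn K m (d K m a) = - d K m (sgn K m a) := by
  induction a using induction_gen with
  | hK x => simp [d_algebraMap]
  | hgen s => rw [d_gen, sgn_d_gen, sgn_gen, map_zsmul, d_gen]
  | hmul a b ha hb =>
    rw [d_mul, map_add, map_mul, map_mul, map_mul, d_mul, ha, hb]
    simp only [neg_mul, mul_neg, neg_add]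
  | hadd a b ha hb => simp only [map_add, ha, hb, neg_add]

theorem sgn_sgn (a : Alg K n) : sgn K m (sgn K m a) = a := by
  induction a using induction_gen with
  | hK x => simp
  | hgen s => rw [sgn_gen, map_zsmul, sgn_gen, smul_smul, sg_mul_self, one_smul]
  | hmul a b ha hb => simp only [map_mul, ha, hb]
  | hadd a b ha hb => simp only [map_add, ha, hb]

theorem sum_triple {M : Type*} [AddCommMonoid M] (p : ℕ) (f : ℕ → ℕ → ℕ → M) :
    ∑ q ∈ Finset.range (p + 1), ∑ t ∈ Finset.range (p - q + 1), f (p - q - t) t q =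
      ∑ q ∈ Finset.range (p + 1), ∑ t ∈ Finset.range (q + 1), f (p - q) (q - t) t := by
  rw [Finset.sum_sigma', Finset.sum_sigma']
  refine Finset.sum_bij' (fun x _ => ⟨x.1 + x.2, x.1⟩) (fun y _ => ⟨y.2, y.1 - y.2⟩) ?_ ?_ ?_ ?_ ?_
  · rintro ⟨q, t⟩ h
    simp only [Finset.mem_sigma, Finset.mem_range] at h ⊢
    omega
  · rintro ⟨q, t⟩ h
    simp only [Finset.mem_sigma, Finset.mem_range] at h ⊢
    omega
  · rintro ⟨q, t⟩ h
    simp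
  · rintro ⟨q, t⟩ h
    simp only [Finset.mem_sigma, Finset.mem_range] at h
    simp only [Sigma.mk.injEq, heq_eq_eq, and_true]
    omega
  · rintro ⟨q, t⟩ h
    simp only [Nat.sub_sub, Nat.add_sub_cancel_left]

theorem d_mul_c (p q : ℕ) (i r j : Fin n) :
    sg (m r + m j) • d K m (c K p r j * c K q i r) =
      sg (m r + m j) • (dc K m p r j * c K q i r) - c K p r j * dc K m q i r := by
  rw [d_mul, d_c, d_c, ← gen_c K p r j, sgn_gen, smul_add, smul_mul_assoc, smul_smul]
  have h : sg (m r + m j) * sg (deg m (.c p r j)) = -1 := by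
    rw [← sg_add]
    have h1 : m r + m j + deg m (.c p r j) = 1 + (m j - p) + (m j - p) := by
      simp only [deg]; ring
    rw [h1, sg_add, sg_add, mul_assoc, sg_mul_self, sg_one, mul_one]
  rw [h, neg_one_smul, sub_eq_add_neg]

theorem d_dc (p : ℕ) (i j : Fin n) : d K m (dc K m p i j) = 0 := by
  have h0 : d K m (if p = 1 ∧ i = j then e K i else 0) = 0 := by
    split_ifs
    · exact d_e K m i
    · exact map_zero _
  have h1 : d K m (dc K m p i j) =
      ∑ q ∈ Finset.range (p + 1), ∑ r : Fin n, sg (m r + m j) • (dc K m (p - q) r j * c K q i r) -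
      ∑ q ∈ Finset.range (p + 1), ∑ r : Fin n, c K (p - q) r j * dc K m q i r := by
    conv_lhs => rw [dc]
    simp only [map_add, h0, zero_add, map_sum, map_zsmul, d_mul_c, Finset.sum_sub_distrib]
  have h2 : ∑ q ∈ Finset.range (p + 1), ∑ r : Fin n,
        sg (m r + m j) • (dc K m (p - q) r j * c K q i r) =
      (if 1 ≤ p then c K (p - 1) i j else 0) +
      ∑ q ∈ Finset.range (p + 1), ∑ t ∈ Finset.range (p - q + 1), ∑ r : Fin n, ∑ s : Fin n,
        sg (m r + m s) • (c K (p - q - t) s j * c K t r s * c K q i r) := by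
    simp only [dc, add_mul, smul_add, Finset.sum_add_distrib]
    congr 1
    · have h3 : ∀ q ∈ Finset.range (p + 1), (∑ r : Fin n, sg (m r + m j) •
          ((if p - q = 1 ∧ r = j then e K r else 0) * c K q i r)) =
          if q + 1 = p then c K q i j else 0 := by
        intro q hq
        have hq' := Finset.mem_range.1 hq
        rw [Finset.sum_eq_single j]
        · by_cases h : q + 1 = p
          · rw [if_pos ⟨by omega, rfl⟩, if_pos h, e_mul_c, sg_add, sg_mul_self, one_smul]
          · rw [if_neg (by omega), if_neg h, zero_mul, smul_zero]
        · intro r _ hr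
          rw [if_neg (fun h => hr h.2), zero_mul, smul_zero]
        · simp
      rw [Finset.sum_congr rfl h3]
      split_ifs with hp
      · rw [Finset.sum_eq_single (p - 1)]
        · rw [if_pos (by omega)]
        · intro q _ hq
          rw [if_neg (by omega)]
        · intro h
          exact absurd (Finset.mem_range.2 (by omega)) h
      · refine Finset.sum_eq_zero fun q _ => if_neg (by omega)
    · refine Finset.sum_congr rfl fun q _ => ?_
      rw [Finset.sum_comm]
      refine Finset.sum_congr rfl fun r _ => ?_
      rw [Finset.sum_mul, Finset.smul_sum]
      refine Finset.sum_congr rfl fun t _ => ?_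
      rw [Finset.sum_mul, Finset.smul_sum]
      refine Finset.sum_congr rfl fun s _ => ?_
      rw [smul_mul_assoc, smul_smul]
      congr 1
      rw [sg_add, sg_add, sg_add]
      linear_combination (sg (m r) * sg (m s)) * sg_mul_self (m j)
  have h4 : ∑ q ∈ Finset.range (p + 1), ∑ r : Fin n, c K (p - q) r j * dc K m q i r =
      (if 1 ≤ p then c K (p - 1) i j else 0) +
      ∑ q ∈ Finset.range (p + 1), ∑ t ∈ Finset.range (q + 1), ∑ r : Fin n, ∑ s : Fin n,
        sg (m r + m s) • (c K (p - q) s j * c K (q - t) r s * c K t i r) := by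
    simp only [dc, mul_add, Finset.sum_add_distrib]
    congr 1
    · have h3 : ∀ q ∈ Finset.range (p + 1), (∑ r : Fin n,
          c K (p - q) r j * (if q = 1 ∧ i = r then e K i else 0)) =
          if q = 1 then c K (p - 1) i j else 0 := by
        intro q hq
        rw [Finset.sum_eq_single i]
        · by_cases h : q = 1
          · rw [if_pos ⟨h, rfl⟩, if_pos h, h, c_mul_e]
          · rw [if_neg (fun h' => h h'.1), if_neg h, mul_zero]
        · intro r _ hr
          rw [if_neg (fun h => hr h.2.symm), mul_zero]
        · simp
      rw [Finset.sum_congr rfl h3, Finset.sum_ite_eq']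
      have h5 : 1 ∈ Finset.range (p + 1) ↔ 1 ≤ p := by
        rw [Finset.mem_range]
        omega
      simp only [h5]
    · refine Finset.sum_congr rfl fun q _ => ?_
      simp only [Finset.mul_sum]
      rw [Finset.sum_comm]
      refine Finset.sum_congr rfl fun t _ => ?_
      rw [Finset.sum_comm]
      refine Finset.sum_congr rfl fun r _ => Finset.sum_congr rfl fun s _ => ?_
      rw [mul_smul_comm, mul_assoc]
  rw [h1, h2, h4, sum_triple p (fun a b g => ∑ r : Fin n, ∑ s : Fin n,
    sg (m r + m s) • (c K a s j * c K b r s * c K g i r)), sub_self]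

theorem d_d (a : Alg K n) : d K m (d K m a) = 0 := by
  induction a using induction_gen with
  | hK x => simp [d_algebraMap]
  | hgen s =>
    cases s with
    | e i => rw [gen_e, d_e, map_zero]
    | c p i j => rw [gen_c, d_c, d_dc]
  | hmul a b ha hb =>
    rw [d_mul, map_add, d_mul, d_mul, ha, hb, sgn_d]
    simp
  | hadd a b ha hb => simp only [map_add, ha, hb, add_zero]

end

/-! ### The DG-algebras -/

/-- The internal DG-algebra on `n` strands, over `⨁ K e_i`, which is identified with `Fin n → K`. -/
noncomputable def internal (K : Type u) [Field K] (n : ℕ) (m : Fin n → ℤ) :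
    DGAlg K (Fin n → K) where
  carrier := Alg K n
  unit := unit K n
  gr := gr K m
  gr_internal := gr_internal K m
  unit_mem := unit_mem_gr K m
  mul_mem := mul_mem_gr K m
  d := d K m
  d_mem := d_mem_gr K m
  d_unit := d_unit K m
  leibniz := leibniz_gr K m
  d_d := d_d K m

/-- The subalgebra generated over `⨁ K e_i` by the `c^0_{ij}` and the `c^1_{ij}`. -/
noncomputable def subalg (K : Type u) [Field K] (n : ℕ) : Subalgebra K (Alg K n) :=
  Algebra.adjoin K ({x | ∃ i, x = e K i} ∪ {x | ∃ p ≤ 1, ∃ i j, x = c K p i j})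

theorem e_mem_subalg (K : Type u) [Field K] {n : ℕ} (i : Fin n) : e K i ∈ subalg K n :=
  Algebra.subset_adjoin (Or.inl ⟨i, rfl⟩)

theorem c_mem_subalg (K : Type u) [Field K] {n p : ℕ} (hp : p ≤ 1) (i j : Fin n) :
    c K p i j ∈ subalg K n :=
  Algebra.subset_adjoin (Or.inr ⟨p, hp, i, j, rfl⟩)

theorem unit_mem_subalg (K : Type u) [Field K] {n : ℕ} (x : Fin n → K) :
    unit K n x ∈ subalg K n := by
  rw [unit_apply]
  exact Subalgebra.sum_mem _ fun i _ => Subalgebra.smul_mem _ (e_mem_subalg K i) _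

theorem d_mem_subalg (K : Type u) [Field K] {n : ℕ} (m : Fin n → ℤ) :
    ∀ a ∈ subalg K n, d K m a ∈ subalg K n := by
  suffices h : ∀ a ∈ subalg K n, sgn K m a ∈ subalg K n ∧ d K m a ∈ subalg K n from
    fun a ha => (h a ha).2
  intro a ha
  induction ha using Algebra.adjoin_induction with
  | mem x hx =>
    rcases hx with ⟨i, rfl⟩ | ⟨p, hp, i, j, rfl⟩
    · rw [d_e]
      refine ⟨?_, Subalgebra.zero_mem _⟩
      rw [← gen_e, sgn_gen]
      exact zsmul_mem (e_mem_subalg K i) _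
    · refine ⟨?_, ?_⟩
      · rw [← gen_c, sgn_gen]
        exact zsmul_mem (c_mem_subalg K hp i j) _
      · rw [d_c, dc]
        refine Subalgebra.add_mem _ ?_ (Subalgebra.sum_mem _ fun q hq =>
          Subalgebra.sum_mem _ fun r _ => zsmul_mem ?_ _)
        · split_ifs
          · exact e_mem_subalg K i
          · exact Subalgebra.zero_mem _
        · have hq' := Finset.mem_range.1 hq
          exact Subalgebra.mul_mem _ (c_mem_subalg K (by omega) _ _)
            (c_mem_subalg K (by omega) _ _)
  | algebraMap x =>
    rw [d_algebraMap, AlgHom.commutes]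
    exact ⟨Subalgebra.algebraMap_mem _ x, Subalgebra.zero_mem _⟩
  | add x y _ _ hx hy =>
    rw [map_add, map_add]
    exact ⟨Subalgebra.add_mem _ hx.1 hy.1, Subalgebra.add_mem _ hx.2 hy.2⟩
  | mul x y hx' hy' hx hy =>
    rw [map_mul, d_mul]
    exact ⟨Subalgebra.mul_mem _ hx.1 hy.1, Subalgebra.add_mem _
      (Subalgebra.mul_mem _ hx.2 hy') (Subalgebra.mul_mem _ hx.1 hy.2)⟩

theorem iSup_subalg (K : Type u) [Field K] {n : ℕ} (m : Fin n → ℤ) :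
    ⨆ i, (gr K m i).comap (subalg K n).val.toLinearMap = ⊤ := by
  have h := word_adjoin_le K m
    ({x | ∃ i, x = e K i} ∪ {x | ∃ p ≤ 1, ∃ i j, x = c K p i j}) (by
      rintro _ (⟨i, rfl⟩ | ⟨p, _, i, j, rfl⟩)
      · exact ⟨_, gen_mem K m (.e i)⟩
      · exact ⟨_, gen_mem K m (.c p i j)⟩)
  refine eq_top_iff.2 fun x _ => ?_
  have hle : (⨆ k, gr K m k ⊓ Subalgebra.toSubmodule (subalg K n)) ≤
      (⨆ i, (gr K m i).comap (subalg K n).val.toLinearMap).map (subalg K n).val.toLinearMap := by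
    rw [Submodule.map_iSup]
    refine iSup_mono fun k a ha => ?_
    exact ⟨⟨a, ha.2⟩, ha.1, rfl⟩
  obtain ⟨y, hy, hxy⟩ := hle (h x.2)
  have : y = x := Subtype.ext hxy
  exact this ▸ hy

/-- The DG-subalgebra of the internal DG-algebra generated by the `c^0_{ij}` and the
`c^1_{ij}`. -/
noncomputable def internalSub (K : Type u) [Field K] (n : ℕ) (m : Fin n → ℤ) :
    DGAlg K (Fin n → K) :=
  (internal K n m).sub (subalg K n) (unit_mem_subalg K) (d_mem_subalg K m) (iSup_subalg K m)

/-- The inclusion of this DG-subalgebra into the internal DG-algebra. -/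
noncomputable def incl (K : Type u) [Field K] (n : ℕ) (m : Fin n → ℤ) :
    DGAlg.Hom (internalSub K n m) (internal K n m) :=
  (internal K n m).subIncl (subalg K n) (unit_mem_subalg K) (d_mem_subalg K m) (iSup_subalg K m)

/-- The product `c^1_{k_s j} ⋯ c^1_{k_1 k_2} c^1_{i k_1}` for a list `k_1, …, k_s`. -/
noncomputable def chain (K : Type u) [Field K] {n : ℕ} (j : Fin n) :
    Fin n → List (Fin n) → Alg K n
  | i, [] => c K 1 i j
  | i, k :: l => chain K j k l * c K 1 i k

end Internal

/-! Absorb the signs by placing `± c^p_{ij}` in row `j`, column `i` of a matrix `c^p`, and let `E`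
be the diagonal matrix of the `e_i`. With `t` a central even variable and `c = ∑ c^p t^p`, the
definition of the differential on generators becomes the single Maurer–Cartan type equation `Dc = tE
+ c²`. A map defined on generators commutes with the differential as soon as the image of `c`
satisfies the same equation.

For the retraction, let `w = ∑ C_k t^k (c^1)^{2k+1}` and `r = c^0 + t w`. Odd powers of `c^1`
satisfy `D (c^1)^{2k+1} = E (c^1)^{2k} + c^0 (c^1)^{2k+1} + (c^1)^{2k+1} c^0` (`dMap_pow`), so `Dr =
tE + r²` reduces to `∑ C_k t^k E (c^1)^{2k} = E + t w²`, which is the Catalan recursion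
(`coeffMap_dMap_rSeries`).

For the quasi-isomorphism, the inclusion followed by the retraction is the identity, and the other
composite is homotopic to the identity. The homotopy `h` is the twisted derivation `h(ab) = h(a) b +
(-1)^{|a|} r(a) h(b)` with `h(c) = v (c - r)`, where `v = ∑ a_k t^k (c^1)^{2k+1}`. The two
Maurer–Cartan equations give `Dh(c) + hD(c) = (Dv - v r - r v)(c - r)`. Since `E (c - r) = c - r`,
it is enough that `Dv = E + v r + r v`; the terms in `c^0` match automatically, and the rest is the
recursion `a_0 = 1`, `a_{k+1} = 2 ∑ a_i C_{k-i}` (`evenSeries_homotopyCoeff`, `coeffMap_homotopy`).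
The identity `dh + hd = 1 - r` then extends from generators to products (`d_htpy_add_htpy_d`). All
coefficients are integers, so the characteristic of the field plays no role. -/

theorem sg_smul_smul {M : Type*} [AddCommGroup M] (k : ℤ) (x : M) : sg k • sg k • x = x := by
  rw [smul_smul, sg_mul_self, one_smul]

/-- The coefficientwise extension of an additive map to power series. -/
noncomputable def coeffMap {M : Type*} [Ring M] (F : M →+ M) : PowerSeries M →+ PowerSeries M where
  toFun f := PowerSeries.mk fun k => F (PowerSeries.coeff k f)
  map_zero' := by ext; simp
  map_add' f g := by ext; simp

/-! ### Coefficientwise maps on power series -/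

section

variable {M : Type*} [Ring M]

theorem coeff_coeffMap (F : M →+ M) (k : ℕ) (f : PowerSeries M) :
    PowerSeries.coeff k (coeffMap F f) = F (PowerSeries.coeff k f) := by
  simp [coeffMap]

theorem coeff_X_mul_C (k : ℕ) (a : M) :
    PowerSeries.coeff k (PowerSeries.X * PowerSeries.C a) = if k = 1 then a else 0 := by
  rw [PowerSeries.coeff_mul_C, PowerSeries.coeff_X, ite_mul, one_mul, zero_mul]

theorem coeffMap_C (F : M →+ M) (a : M) :
    coeffMap F (PowerSeries.C a) = PowerSeries.C (F a) := by
  ext k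
  simp only [coeff_coeffMap, PowerSeries.coeff_C]
  split_ifs <;> simp

theorem coeffMap_X_mul (F : M →+ M) (f : PowerSeries M) :
    coeffMap F (PowerSeries.X * f) = PowerSeries.X * coeffMap F f := by
  ext k
  cases k <;> simp [coeff_coeffMap, PowerSeries.coeff_succ_X_mul]

/-- The variable is central and counts as even, so moving an operator past its powers produces no
sign. -/
theorem coeffMap_mul (D φ : M →+ M) (h : ∀ a b, D (a * b) = D a * b + φ a * D b)
    (f g : PowerSeries M) :
    coeffMap D (f * g) = coeffMap D f * g + coeffMap φ f * coeffMap D g := by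
  ext k
  simp only [coeff_coeffMap, PowerSeries.coeff_mul, map_add, map_sum, h, Finset.sum_add_distrib]

end

namespace Internal

section

variable (K : Type u) [Field K] {n : ℕ} (m : Fin n → ℤ)

/-! ### Matrices over the algebra -/

/-- The matrix with entries `± c^p_{ij}` in row `j` and column `i`. -/
noncomputable def cMat (p : ℕ) : Matrix (Fin n) (Fin n) (Alg K n) :=
  Matrix.of fun j i => sg (m j) • c K p i j

/-- The diagonal matrix with entries `e_i`. -/
noncomputable def eMat : Matrix (Fin n) (Fin n) (Alg K n) := Matrix.diagonal (e K)

theorem eMat_mul_apply (A : Matrix (Fin n) (Fin n) (Alg K n)) (j i : Fin n) :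
    ((eMat K * A : Matrix _ _ _) j i) = e K j * A j i := by
  rw [eMat, Matrix.diagonal_mul]

theorem mul_eMat_apply (A : Matrix (Fin n) (Fin n) (Alg K n)) (j i : Fin n) :
    ((A * eMat K : Matrix _ _ _) j i) = A j i * e K i := by
  rw [eMat, Matrix.mul_diagonal]

theorem cMat_apply (p : ℕ) (i j : Fin n) : cMat K m p j i = sg (m j) • c K p i j := rfl

theorem eMat_mul_cMat (p : ℕ) : eMat K * cMat K m p = cMat K m p := by
  ext j i
  rw [eMat_mul_apply, cMat_apply, mul_smul_comm, e_mul_c]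

theorem cMat_mul_eMat (p : ℕ) : cMat K m p * eMat K = cMat K m p := by
  ext j i
  rw [mul_eMat_apply, cMat_apply, smul_mul_assoc, c_mul_e]

variable {K}

/-- The entrywise application of an odd map, with signs. -/
noncomputable def oddMap (D : Alg K n →+ Alg K n) :
    Matrix (Fin n) (Fin n) (Alg K n) →+ Matrix (Fin n) (Fin n) (Alg K n) where
  toFun A := Matrix.of fun j i => sg (m j) • D (A j i)
  map_zero' := by ext; simp
  map_add' A B := by ext; simp

/-- The entrywise application of an even map, with signs. -/
noncomputable def evenMap (φ : Alg K n →+ Alg K n) :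
    Matrix (Fin n) (Fin n) (Alg K n) →+ Matrix (Fin n) (Fin n) (Alg K n) where
  toFun A := Matrix.of fun j i => sg (m j) • sg (m i) • φ (A j i)
  map_zero' := by ext; simp
  map_add' A B := by ext; simp

theorem oddMap_apply (D : Alg K n →+ Alg K n) (A : Matrix (Fin n) (Fin n) (Alg K n))
    (j i : Fin n) : oddMap m D A j i = sg (m j) • D (A j i) := rfl

theorem evenMap_apply (φ : Alg K n →+ Alg K n) (A : Matrix (Fin n) (Fin n) (Alg K n))
    (j i : Fin n) : evenMap m φ A j i = sg (m j) • sg (m i) • φ (A j i) := rfl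

/-- The signs are chosen so that the sum over the middle index `r` works: the column sign of
`evenMap` and the row sign of `oddMap` are both `sg (m r)` and cancel. -/
theorem oddMap_mul {D φ : Alg K n →+ Alg K n} (h : ∀ a b, D (a * b) = D a * b + φ a * D b)
    (A B : Matrix (Fin n) (Fin n) (Alg K n)) :
    oddMap m D (A * B) = oddMap m D A * B + evenMap m φ A * oddMap m D B := by
  ext j i
  simp only [oddMap_apply, evenMap_apply, Matrix.add_apply, Matrix.mul_apply, map_sum, h,
    Finset.sum_add_distrib, smul_add, Finset.smul_sum]
  congr 1
  · exact Finset.sum_congr rfl fun r _ => (smul_mul_assoc _ _ _).symm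
  · refine Finset.sum_congr rfl fun r _ => ?_
    rw [smul_mul_assoc, smul_mul_smul_comm, sg_mul_self, one_smul]

/-- The matrix `A`, with entries from the `i`-th to the `j`-th object in row `j` and column `i`,
is homogeneous of degree `k` up to the shifts `m`. -/
def MatDeg (k : ℤ) (A : Matrix (Fin n) (Fin n) (Alg K n)) : Prop :=
  ∀ j i, A j i ∈ gr K m (k + m j - m i)

variable {m}

theorem MatDeg.mul {k l : ℤ} {A B : Matrix (Fin n) (Fin n) (Alg K n)} (hA : MatDeg m k A)
    (hB : MatDeg m l B) : MatDeg m (k + l) (A * B) := by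
  intro j i
  rw [Matrix.mul_apply]
  refine Submodule.sum_mem _ fun r _ => ?_
  have h := mul_mem_gr K m (hA j r) (hB r i)
  convert h using 2
  ring

theorem MatDeg.nsmul {k : ℤ} {A : Matrix (Fin n) (Fin n) (Alg K n)} (hA : MatDeg m k A)
    (a : ℕ) : MatDeg m k (a • A) := fun j i => nsmul_mem (hA j i) a

theorem MatDeg.sub {k : ℤ} {A B : Matrix (Fin n) (Fin n) (Alg K n)} (hA : MatDeg m k A)
    (hB : MatDeg m k B) : MatDeg m k (A - B) := fun j i => Submodule.sub_mem _ (hA j i) (hB j i)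

theorem MatDeg.sum {ι : Type*} {s : Finset ι} {k : ℤ}
    {A : ι → Matrix (Fin n) (Fin n) (Alg K n)} (hA : ∀ t ∈ s, MatDeg m k (A t)) :
    MatDeg m k (∑ t ∈ s, A t) := by
  intro j i
  rw [Matrix.sum_apply]
  exact Submodule.sum_mem _ fun t ht => hA t ht j i

/-- The row and column signs cancel the contribution `m j - m i` to the parity of an entry. In the
matrix Leibniz rule a homogeneous matrix therefore contributes one global sign, free of the shifts
`m`. -/
theorem MatDeg.evenMap_sgn {k : ℤ} {A : Matrix (Fin n) (Fin n) (Alg K n)} (hA : MatDeg m k A) :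
    evenMap m (sgn K m : Alg K n →+ Alg K n) A = sg k • A := by
  ext j i
  rw [evenMap_apply]
  change _ • _ • sgn K m (A j i) = sg k • A j i
  rw [sgn_of_mem K m (hA j i), smul_smul, smul_smul, ← sg_add, ← sg_add]
  have h : m j + m i + (k + m j - m i) = m j + (m j + k) := by ring
  rw [h, sg_add, sg_add, ← mul_assoc, sg_mul_self, one_mul]

variable (K m)

theorem cMat_deg (p : ℕ) : MatDeg m (1 - 2 * p) (cMat K m p) :=
  fun j i => zsmul_mem (c_mem K m p i j) _

theorem cMat_pow_deg (k : ℕ) : MatDeg m (-(k + 1)) (cMat K m 1 ^ (k + 1)) := by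
  induction k with
  | zero =>
    have h := cMat_deg K m 1
    norm_num at h ⊢
    exact h
  | succ k ih =>
    rw [pow_succ]
    have h := ih.mul (cMat_deg K m 1)
    convert h using 1
    push_cast
    ring

/-- The differential on matrices over the algebra. -/
noncomputable def dMap :
    Matrix (Fin n) (Fin n) (Alg K n) →+ Matrix (Fin n) (Fin n) (Alg K n) :=
  oddMap m (d K m).toAddMonoidHom

theorem dMap_mul (A B : Matrix (Fin n) (Fin n) (Alg K n)) :
    dMap K m (A * B) =
      dMap K m A * B + evenMap m (sgn K m : Alg K n →+ Alg K n) A * dMap K m B :=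
  oddMap_mul m (fun a b => d_mul K m a b) A B

theorem dMap_cMat_apply (p : ℕ) (i j : Fin n) : dMap K m (cMat K m p) j i = dc K m p i j := by
  change sg (m j) • d K m (sg (m j) • c K p i j) = _
  rw [map_zsmul, sg_smul_smul, d_c]

theorem dMap_eMat : dMap K m (eMat K) = 0 := by
  ext j i
  change sg (m j) • d K m (Matrix.diagonal (e K) j i) = 0
  by_cases h : j = i
  · subst h
    rw [Matrix.diagonal_apply_eq, d_e, smul_zero]
  · rw [Matrix.diagonal_apply_ne _ h, map_zero, smul_zero]

/-- The normalisation of `cMat` absorbs every sign `(-1)^{m_r+m_j}`, leaving plain matrix products.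
-/
theorem dMap_cMat (p : ℕ) : dMap K m (cMat K m p) = (if p = 1 then eMat K else 0) +
    ∑ q ∈ Finset.HasAntidiagonal.antidiagonal p, cMat K m q.1 * cMat K m q.2 := by
  ext j i
  rw [dMap_cMat_apply, dc, Matrix.add_apply, Matrix.sum_apply]
  congr 1
  · by_cases hp : p = 1
    · rw [if_pos hp, eMat]
      by_cases h : i = j
      · rw [if_pos ⟨hp, h⟩, h, Matrix.diagonal_apply_eq]
      · rw [if_neg (fun h' => h h'.2), Matrix.diagonal_apply_ne' _ h]
    · rw [if_neg hp, if_neg (fun h => hp h.1), Matrix.zero_apply]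
  · rw [← Finset.Nat.sum_antidiagonal_swap,
      Finset.Nat.sum_antidiagonal_eq_sum_range_succ_mk]
    refine Finset.sum_congr rfl fun q _ => ?_
    rw [Matrix.mul_apply]
    refine Finset.sum_congr rfl fun r _ => ?_
    simp only [Prod.fst_swap, Prod.snd_swap, cMat_apply]
    rw [smul_mul_smul_comm, ← sg_add, add_comm]

theorem eMat_mul_pow (k : ℕ) : eMat K * cMat K m 1 ^ (k + 1) = cMat K m 1 ^ (k + 1) := by
  rw [pow_succ', ← mul_assoc, eMat_mul_cMat]

theorem pow_mul_eMat (k : ℕ) : cMat K m 1 ^ (k + 1) * eMat K = cMat K m 1 ^ (k + 1) := by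
  rw [pow_succ, mul_assoc, cMat_mul_eMat]

theorem dMap_cMat_one_mul (A : Matrix (Fin n) (Fin n) (Alg K n)) :
    dMap K m (cMat K m 1 * A) =
      eMat K * A + cMat K m 0 * cMat K m 1 * A + cMat K m 1 * cMat K m 0 * A -
        cMat K m 1 * dMap K m A := by
  have h : sg (1 - 2 * ((1 : ℕ) : ℤ)) = -1 := by norm_num [sg]
  rw [dMap_mul, (cMat_deg K m 1).evenMap_sgn, h, dMap_cMat, if_pos rfl,
    Finset.Nat.sum_antidiagonal_eq_sum_range_succ_mk]
  simp only [Finset.sum_range_succ, Finset.sum_range_zero, zero_add, Nat.sub_zero, Nat.sub_self,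
    neg_smul, one_smul, neg_mul, add_mul]
  abel

/-- Since `c^1` is odd, multiplying by it twice makes the inner terms cancel in pairs, and only the
terms with `c^0` at an end and a single `E (c^1)^{2k}` survive. The factor `E` matters only for `k =
0`, where the zeroth power is the identity matrix and not `E`. -/
theorem dMap_pow (k : ℕ) : dMap K m (cMat K m 1 ^ (2 * k + 1)) =
    eMat K * cMat K m 1 ^ (2 * k) + cMat K m 0 * cMat K m 1 ^ (2 * k + 1) +
      cMat K m 1 ^ (2 * k + 1) * cMat K m 0 := by
  induction k with
  | zero =>
    -- The base case uses `c^1 = c^1 E`, where `E` is closed.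
    have h := dMap_cMat_one_mul K m (eMat K)
    rw [cMat_mul_eMat, dMap_eMat, mul_assoc, cMat_mul_eMat, mul_assoc, cMat_mul_eMat] at h
    have he : eMat K * eMat K = (eMat K : Matrix (Fin n) (Fin n) (Alg K n)) := by
      rw [eMat, Matrix.diagonal_mul_diagonal]
      simp only [e_mul_self]
    simpa [he] using h
  | succ k ih =>
    have h1 : cMat K m 1 ^ (2 * (k + 1) + 1) =
        cMat K m 1 * (cMat K m 1 * cMat K m 1 ^ (2 * k + 1)) := by
      rw [← pow_succ', ← pow_succ', show 2 * (k + 1) = 2 * k + 1 + 1 from rfl]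
    have h2 : cMat K m 1 * (eMat K * cMat K m 1 ^ (2 * k)) =
        eMat K * (cMat K m 1 * cMat K m 1 ^ (2 * k)) := by
      rw [← mul_assoc, ← mul_assoc, cMat_mul_eMat, eMat_mul_cMat]
    rw [h1, dMap_cMat_one_mul, dMap_cMat_one_mul, ih]
    rw [show 2 * (k + 1) = 2 * k + 1 + 1 from rfl, pow_succ' _ (2 * k + 1), pow_succ' _ (2 * k)]
    simp only [mul_add, mul_sub, h2]
    simp only [← mul_assoc]
    abel

/-! ### Generating series -/

/-- The series `∑ c^p t^p`. -/
noncomputable def cSeries : PowerSeries (Matrix (Fin n) (Fin n) (Alg K n)) :=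
  PowerSeries.mk (cMat K m)

/-- The series of the odd powers of `c^1` with coefficients `a`. -/
noncomputable def oddSeries (a : ℕ → ℕ) : PowerSeries (Matrix (Fin n) (Fin n) (Alg K n)) :=
  PowerSeries.mk fun k => a k • cMat K m 1 ^ (2 * k + 1)

/-- The series of the even powers of `c^1` with coefficients `a`. -/
noncomputable def evenSeries (a : ℕ → ℕ) : PowerSeries (Matrix (Fin n) (Fin n) (Alg K n)) :=
  PowerSeries.mk fun k => a k • (eMat K * cMat K m 1 ^ (2 * k))

/-- The Maurer–Cartan equation `Dc = tE + c²`, which encodes the differential of all generators at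
once. -/
theorem coeffMap_dMap_cSeries : coeffMap (dMap K m) (cSeries K m) =
    PowerSeries.X * PowerSeries.C (eMat K) + cSeries K m * cSeries K m := by
  ext1 p
  rw [coeff_coeffMap, cSeries, PowerSeries.coeff_mk, dMap_cMat, map_add,
    PowerSeries.coeff_mul p (PowerSeries.mk (cMat K m))]
  simp only [PowerSeries.coeff_mk]
  congr 1
  exact (coeff_X_mul_C p _).symm

theorem coeffMap_dMap_oddSeries (a : ℕ → ℕ) : coeffMap (dMap K m) (oddSeries K m a) =
    evenSeries K m a + PowerSeries.C (cMat K m 0) * oddSeries K m a +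
      oddSeries K m a * PowerSeries.C (cMat K m 0) := by
  ext1 k
  simp only [coeff_coeffMap, oddSeries, evenSeries, PowerSeries.coeff_mk, map_add, map_nsmul,
    dMap_pow, PowerSeries.coeff_C_mul, PowerSeries.coeff_mul_C, smul_add, mul_smul_comm,
    smul_mul_assoc]

theorem coeff_oddSeries_mul (a b : ℕ → ℕ) (k : ℕ) :
    PowerSeries.coeff k (oddSeries K m a * oddSeries K m b) =
      (∑ q ∈ Finset.HasAntidiagonal.antidiagonal k, a q.1 * b q.2) • cMat K m 1 ^ (2 * k + 2) := by
  rw [PowerSeries.coeff_mul, Finset.sum_smul]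
  refine Finset.sum_congr rfl fun q hq => ?_
  rw [oddSeries, oddSeries, PowerSeries.coeff_mk, PowerSeries.coeff_mk, smul_mul_smul_comm,
    ← pow_add, ← Finset.HasAntidiagonal.mem_antidiagonal.1 hq]
  congr 2
  ring

/-- Turns a convolution recursion for integers into an identity of series. It is used for the
Catalan numbers and for the coefficients of the homotopy. -/
theorem evenSeries_eq {a b f : ℕ → ℕ} (h0 : a 0 = 1)
    (h : ∀ k, a (k + 1) = ∑ q ∈ Finset.HasAntidiagonal.antidiagonal k, b q.1 * f q.2) :
    evenSeries K m a =
      PowerSeries.C (eMat K) + PowerSeries.X * (oddSeries K m b * oddSeries K m f) := by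
  ext1 k
  rcases k with _ | k
  · simp [evenSeries, h0]
  · rw [map_add, PowerSeries.coeff_succ_X_mul, coeff_oddSeries_mul, evenSeries,
      PowerSeries.coeff_mk, ← h, PowerSeries.coeff_C, if_neg (Nat.succ_ne_zero k), zero_add,
      show 2 * (k + 1) = 2 * k + 1 + 1 from rfl, eMat_mul_pow]

/-- All coefficients are multiples of powers of the one matrix `c^1`. -/
theorem oddSeries_mul_comm (a b : ℕ → ℕ) :
    oddSeries K m a * oddSeries K m b = oddSeries K m b * oddSeries K m a := by
  ext1 k
  rw [coeff_oddSeries_mul, coeff_oddSeries_mul, ← Finset.Nat.sum_antidiagonal_swap]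
  simp only [Prod.fst_swap, Prod.snd_swap, mul_comm]

end

end Internal

namespace Internal

section

variable (K : Type u) [Field K] {n : ℕ} (m : Fin n → ℤ)

/-! ### The retraction -/

/-- The matrix with entries `± r(c^p_{ij})`. -/
noncomputable def rMat : ℕ → Matrix (Fin n) (Fin n) (Alg K n)
  | 0 => cMat K m 0
  | p + 1 => catalan p • cMat K m 1 ^ (2 * p + 1)

theorem rMat_one : rMat K m 1 = cMat K m 1 := by simp [rMat]

theorem eMat_mul_rMat (p : ℕ) : eMat K * rMat K m p = rMat K m p := by
  cases p with
  | zero => exact eMat_mul_cMat K m 0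
  | succ p => rw [rMat, mul_smul_comm, eMat_mul_pow]

theorem rMat_mul_eMat (p : ℕ) : rMat K m p * eMat K = rMat K m p := by
  cases p with
  | zero => exact cMat_mul_eMat K m 0
  | succ p => rw [rMat, smul_mul_assoc, pow_mul_eMat]

theorem rMat_deg (p : ℕ) : MatDeg m (1 - 2 * p) (rMat K m p) := by
  cases p with
  | zero => exact cMat_deg K m 0
  | succ p =>
    have h := (cMat_pow_deg K m (2 * p)).nsmul (catalan p)
    rw [rMat]
    convert h using 1
    push_cast
    ring

theorem e_mul_of_eMat_mul {A : Matrix (Fin n) (Fin n) (Alg K n)} (h : eMat K * A = A)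
    (i j : Fin n) : e K j * A j i = A j i := by
  rw [← eMat_mul_apply, h]

theorem mul_e_of_mul_eMat {A : Matrix (Fin n) (Fin n) (Alg K n)} (h : A * eMat K = A)
    (i j : Fin n) : A j i * e K i = A j i := by
  rw [← mul_eMat_apply, h]

/-- The retraction, as an endomorphism of the algebra. -/
noncomputable def retr : Alg K n →ₐ[K] Alg K n :=
  lift (fun | .e i => e K i | .c p i j => sg (m j) • rMat K m p j i)
    (fun i => e_mul_self K i)
    (fun _ _ h => e_mul_e K h)
    (sum_e K)
    (fun p i j => by
      dsimp only
      rw [mul_smul_comm, e_mul_of_eMat_mul K (eMat_mul_rMat K m p)])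
    (fun p i j => by
      dsimp only
      rw [smul_mul_assoc, mul_e_of_mul_eMat K (rMat_mul_eMat K m p)])
    (fun i j h => by
      dsimp only
      rw [rMat, cMat_apply, c_zero K h, smul_zero, smul_zero])

theorem retr_e (i : Fin n) : retr K m (e K i) = e K i := lift_gen _ _ _ _ _ _ _ (.e i)

theorem retr_c (p : ℕ) (i j : Fin n) : retr K m (c K p i j) = sg (m j) • rMat K m p j i :=
  lift_gen _ _ _ _ _ _ _ (.c p i j)

theorem retr_c_of_le_one {p : ℕ} (hp : p ≤ 1) (i j : Fin n) :
    retr K m (c K p i j) = c K p i j := by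
  rw [retr_c]
  interval_cases p
  · rw [rMat, cMat_apply, sg_smul_smul]
  · rw [rMat_one, cMat_apply, sg_smul_smul]

theorem map_retr_cMat (p : ℕ) : (retr K m).mapMatrix (cMat K m p) = rMat K m p := by
  ext j i
  rw [AlgHom.mapMatrix_apply, Matrix.map_apply, cMat_apply, map_zsmul, retr_c, sg_smul_smul]

theorem map_retr_eMat : (retr K m).mapMatrix (eMat K) = eMat K := by
  rw [AlgHom.mapMatrix_apply, eMat, Matrix.diagonal_map (map_zero _)]
  simp only [retr_e]

theorem retr_gen_mem (s : Symbol n) : retr K m (gen K s) ∈ gr K m (deg m s) := by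
  cases s with
  | e i =>
    rw [gen_e, retr_e]
    exact gen_mem K m (.e i)
  | c p i j =>
    rw [gen_c, retr_c]
    exact zsmul_mem (rMat_deg K m p j i) _

theorem retr_mem {k : ℤ} {a : Alg K n} (ha : a ∈ gr K m k) : retr K m a ∈ gr K m k := by
  induction ha using Submodule.span_induction with
  | mem x hx =>
    obtain ⟨l, rfl, rfl⟩ := hx
    induction l with
    | nil => simpa using one_mem_gr K m
    | cons s l ih =>
      simp only [List.map_cons, List.prod_cons, List.sum_cons, map_mul]
      exact mul_mem_gr K m (retr_gen_mem K m s) ih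
  | zero => rw [map_zero]; exact Submodule.zero_mem _
  | add x y _ _ hx hy => rw [map_add]; exact Submodule.add_mem _ hx hy
  | smul t x _ hx => rw [map_smul]; exact Submodule.smul_mem _ _ hx

theorem sgn_retr (a : Alg K n) : sgn K m (retr K m a) = retr K m (sgn K m a) := by
  induction a using induction_gen with
  | hK x => simp
  | hgen s => rw [sgn_of_mem K m (retr_gen_mem K m s), sgn_gen, map_zsmul]
  | hmul a b ha hb => simp only [map_mul, ha, hb]
  | hadd a b ha hb => simp only [map_add, ha, hb]

/-- The series with coefficients `rMat`. -/
noncomputable def rSeries : PowerSeries (Matrix (Fin n) (Fin n) (Alg K n)) :=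
  PowerSeries.mk (rMat K m)

theorem rSeries_eq : rSeries K m =
    PowerSeries.C (cMat K m 0) + PowerSeries.X * oddSeries K m catalan := by
  ext1 p
  rcases p with _ | p
  · simp [rSeries, rMat]
  · rw [map_add, PowerSeries.coeff_succ_X_mul, rSeries, oddSeries, PowerSeries.coeff_mk,
      PowerSeries.coeff_mk, PowerSeries.coeff_C, if_neg (Nat.succ_ne_zero p), zero_add, rMat]

theorem dMap_cMat_zero : dMap K m (cMat K m 0) = cMat K m 0 * cMat K m 0 := by
  rw [dMap_cMat]
  simp

/-- With `r = c^0 + t w`, the square `r²` consists of `(c^0)² = D c^0`, the mixed terms `t (c^0 w +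
w c^0)`, which `D (t w)` also contains, and `t² w²`. The remaining part of `D (t w)` is `t (E + t
w²)` by the Catalan recursion. -/
theorem coeffMap_dMap_rSeries : coeffMap (dMap K m) (rSeries K m) =
    PowerSeries.X * PowerSeries.C (eMat K) + rSeries K m * rSeries K m := by
  have hX : ∀ f : PowerSeries (Matrix (Fin n) (Fin n) (Alg K n)),
      f * PowerSeries.X = PowerSeries.X * f := fun f => PowerSeries.commute_X f
  rw [rSeries_eq, map_add, coeffMap_C, coeffMap_X_mul, coeffMap_dMap_oddSeries, dMap_cMat_zero,
    map_mul, evenSeries_eq K m (b := catalan) (f := catalan) catalan_zero catalan_succ']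
  have h1 : PowerSeries.C (cMat K m 0) * (PowerSeries.X * oddSeries K m catalan) =
      PowerSeries.X * (PowerSeries.C (cMat K m 0) * oddSeries K m catalan) := by
    rw [← mul_assoc, hX, mul_assoc]
  have h2 : oddSeries K m catalan * (PowerSeries.X * oddSeries K m catalan) =
      PowerSeries.X * (oddSeries K m catalan * oddSeries K m catalan) := by
    rw [← mul_assoc, hX, mul_assoc]
  simp only [add_mul, mul_add, mul_assoc, h1, h2]
  abel

theorem dMap_rMat (p : ℕ) : dMap K m (rMat K m p) = (if p = 1 then eMat K else 0) +
    ∑ q ∈ Finset.HasAntidiagonal.antidiagonal p, rMat K m q.1 * rMat K m q.2 := by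
  have h := congrArg (PowerSeries.coeff p) (coeffMap_dMap_rSeries K m)
  rw [coeff_coeffMap, map_add, rSeries, PowerSeries.coeff_mul p (PowerSeries.mk (rMat K m)),
    PowerSeries.coeff_mk] at h
  simp only [PowerSeries.coeff_mk] at h
  rw [h]
  congr 1
  exact coeff_X_mul_C p _

/-- Compatibility with the differential on generators: `c` and `r` solve the same quadratic
equation, and the retraction carries one to the other and fixes `E`. -/
theorem map_retr_dMap_cMat (p : ℕ) :
    (retr K m).mapMatrix (dMap K m (cMat K m p)) = dMap K m (rMat K m p) := by
  rw [dMap_cMat, dMap_rMat, map_add, map_sum]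
  simp only [map_mul, map_retr_cMat]
  congr 1
  split_ifs
  · exact map_retr_eMat K m
  · exact map_zero _

theorem retr_d (a : Alg K n) : retr K m (d K m a) = d K m (retr K m a) := by
  induction a using induction_gen with
  | hK x => simp [d_algebraMap]
  | hgen s =>
    cases s with
    | e i => rw [gen_e, retr_e, d_e, map_zero]
    | c p i j =>
      have h := congrFun (congrFun (map_retr_dMap_cMat K m p) j) i
      rw [AlgHom.mapMatrix_apply, Matrix.map_apply, dMap_cMat_apply] at h
      rw [gen_c, d_c, h, retr_c, map_zsmul]
      rfl
  -- Since the retraction preserves degrees, it commutes with the sign map in the Leibniz rule.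
  | hmul a b ha hb => rw [d_mul, map_add, map_mul, map_mul, ha, hb, ← sgn_retr, map_mul, d_mul]
  | hadd a b ha hb => simp only [map_add, ha, hb]

/-! ### The image of the retraction and its explicit formula -/

theorem cMat_pow_mem_subalg (k : ℕ) (i j : Fin n) :
    (cMat K m 1 ^ (k + 1)) j i ∈ subalg K n := by
  induction k generalizing i with
  | zero =>
    rw [zero_add, pow_one]
    exact zsmul_mem (c_mem_subalg K le_rfl i j) _
  | succ k ih =>
    rw [pow_succ, Matrix.mul_apply]
    exact Subalgebra.sum_mem _ fun r _ =>
      Subalgebra.mul_mem _ (ih r) (zsmul_mem (c_mem_subalg K le_rfl i r) _)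

theorem retr_mem_subalg (a : Alg K n) : retr K m a ∈ subalg K n := by
  induction a using induction_gen with
  | hK x => rw [AlgHom.commutes]; exact Subalgebra.algebraMap_mem _ x
  | hgen s =>
    cases s with
    | e i => rw [gen_e, retr_e]; exact e_mem_subalg K i
    | c p i j =>
      rw [gen_c, retr_c]
      refine zsmul_mem ?_ _
      cases p with
      | zero => exact zsmul_mem (c_mem_subalg K zero_le_one i j) _
      | succ p => exact nsmul_mem (cMat_pow_mem_subalg K m (2 * p) i j) _
  | hmul a b ha hb => rw [map_mul]; exact Subalgebra.mul_mem _ ha hb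
  | hadd a b ha hb => rw [map_add]; exact Subalgebra.add_mem _ ha hb

theorem retr_of_mem_subalg {a : Alg K n} (ha : a ∈ subalg K n) : retr K m a = a := by
  induction ha using Algebra.adjoin_induction with
  | mem x hx =>
    rcases hx with ⟨i, rfl⟩ | ⟨p, hp, i, j, rfl⟩
    · exact retr_e K m i
    · exact retr_c_of_le_one K m hp i j
  | algebraMap x => exact AlgHom.commutes _ x
  | add x y _ _ hx hy => rw [map_add, hx, hy]
  | mul x y _ _ hx hy => rw [map_mul, hx, hy]

theorem retr_unit (x : Fin n → K) : retr K m (unit K n x) = unit K n x :=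
  retr_of_mem_subalg K m (unit_mem_subalg K x)

/-- The retraction onto the DG-subalgebra generated by the `c^0_{ij}` and the `c^1_{ij}`. -/
noncomputable def retraction : DGAlg.Hom (internal K n m) (internalSub K n m) where
  toAlgHom := (retr K m).codRestrict (subalg K n) (retr_mem_subalg K m)
  map_unit x := Subtype.ext (retr_unit K m x)
  map_mem ha := retr_mem K m ha
  map_d a := Subtype.ext (retr_d K m a)

/-- An entry of a matrix power is a sum over paths. Each factor carries the sign of its target, so
the inner vertices give the sign under the sum and the final vertex `j` the sign in front. -/
theorem cMat_pow_apply (s : ℕ) (i j : Fin n) : (cMat K m 1 ^ (s + 1)) j i =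
    sg (m j) • ∑ k : Fin s → Fin n, sg (∑ t, m (k t)) • chain K j i (List.ofFn k) := by
  induction s generalizing i with
  | zero => simp [chain, sg_zero, cMat_apply]
  | succ s ih =>
    rw [pow_succ, Matrix.mul_apply, ← (Fin.consEquiv fun _ => Fin n).sum_comp,
      Fintype.sum_prod_type, Finset.smul_sum]
    refine Finset.sum_congr rfl fun r _ => ?_
    rw [ih, cMat_apply, smul_mul_assoc, Finset.sum_mul]
    congr 1
    refine Finset.sum_congr rfl fun k _ => ?_
    simp only [Fin.consEquiv_apply, Fin.sum_univ_succ, Fin.cons_zero, Fin.cons_succ,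
      List.ofFn_succ, chain]
    rw [smul_mul_smul_comm, sg_add, mul_comm]

theorem retr_c_eq {p : ℕ} (hp : 1 < p) (i j : Fin n) :
    retr K m (c K p i j) = (catalan (p - 1) : K) • ∑ k : Fin (2 * p - 2) → Fin n,
      sg (∑ t, m (k t)) • chain K j i (List.ofFn k) := by
  obtain ⟨p, rfl⟩ : ∃ q, p = q + 1 := ⟨p - 1, by omega⟩
  have h : 2 * (p + 1) - 2 = 2 * p := by omega
  rw [retr_c, rMat, Matrix.smul_apply, cMat_pow_apply, smul_comm (catalan p), sg_smul_smul, h,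
    Nat.add_sub_cancel, Nat.cast_smul_eq_nsmul]

/-! ### The homotopy -/

/-- The coefficients of `(1 - 4t)^{-1/2}`, the inverse of `1 - 2t ∑ C_k t^k`. -/
def homotopyCoeff : ℕ → ℕ
  | 0 => 1
  | k + 1 => ∑ i : Fin (k + 1), 2 * homotopyCoeff i * catalan (k - i)

theorem homotopyCoeff_succ (k : ℕ) : homotopyCoeff (k + 1) =
    ∑ q ∈ Finset.HasAntidiagonal.antidiagonal k, 2 * homotopyCoeff q.1 * catalan q.2 := by
  rw [homotopyCoeff, Finset.Nat.sum_antidiagonal_eq_sum_range_succ_mk,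
    Finset.sum_range fun i => 2 * homotopyCoeff i * catalan (k - i)]

/-- The series of the values of the homotopy on the `c^p`. -/
noncomputable def homotopySeries : PowerSeries (Matrix (Fin n) (Fin n) (Alg K n)) :=
  oddSeries K m homotopyCoeff * (cSeries K m - rSeries K m)

/-- The matrix of the values of the homotopy on `c^p_{ij}`. -/
noncomputable def homotopyMat (p : ℕ) : Matrix (Fin n) (Fin n) (Alg K n) :=
  PowerSeries.coeff p (homotopySeries K m)

theorem homotopyMat_eq (p : ℕ) : homotopyMat K m p =
    ∑ q ∈ Finset.HasAntidiagonal.antidiagonal p,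
      (homotopyCoeff q.1 • cMat K m 1 ^ (2 * q.1 + 1)) * (cMat K m q.2 - rMat K m q.2) := by
  rw [homotopyMat, homotopySeries, PowerSeries.coeff_mul]
  simp only [oddSeries, cSeries, rSeries, map_sub, PowerSeries.coeff_mk]

theorem eMat_mul_homotopyMat (p : ℕ) : eMat K * homotopyMat K m p = homotopyMat K m p := by
  rw [homotopyMat_eq, Finset.mul_sum]
  refine Finset.sum_congr rfl fun q _ => ?_
  rw [← mul_assoc, mul_smul_comm, eMat_mul_pow]

theorem homotopyMat_mul_eMat (p : ℕ) : homotopyMat K m p * eMat K = homotopyMat K m p := by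
  rw [homotopyMat_eq, Finset.sum_mul]
  refine Finset.sum_congr rfl fun q _ => ?_
  rw [mul_assoc, sub_mul, cMat_mul_eMat, rMat_mul_eMat]

/-- The series `c - r` starts in degree `2` in `t`, because the retraction fixes `c^0` and `c^1`.
The case `p = 0` makes the homotopy respect the relation `c^0_{ij} = 0` for `i ≥ j`. -/
theorem homotopyMat_of_le_one {p : ℕ} (hp : p ≤ 1) : homotopyMat K m p = 0 := by
  rw [homotopyMat_eq]
  refine Finset.sum_eq_zero fun q hq => ?_
  have h : q.1 + q.2 = p := Finset.HasAntidiagonal.mem_antidiagonal.1 hq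
  have h' : q.2 = 0 ∨ q.2 = 1 := by omega
  rcases h' with h' | h' <;> rw [h']
  · rw [rMat, sub_self, mul_zero]
  · rw [rMat_one, sub_self, mul_zero]

theorem homotopyMat_deg (p : ℕ) : MatDeg m (-(2 * p)) (homotopyMat K m p) := by
  rw [homotopyMat_eq]
  refine MatDeg.sum fun q hq => ?_
  have h := ((cMat_pow_deg K m (2 * q.1)).nsmul (homotopyCoeff q.1)).mul
    ((cMat_deg K m q.2).sub (rMat_deg K m q.2))
  rw [← Finset.HasAntidiagonal.mem_antidiagonal.1 hq]
  convert h using 1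
  push_cast
  ring

/-- The value of the homotopy on the symbols. -/
noncomputable def hgen : Symbol n → Alg K n
  | .e _ => 0
  | .c p i j => homotopyMat K m p j i

/-- The algebra map `a ↦ [(-1)^{|a|} r(a), h(a); 0, a]`, where `h` is the homotopy. -/
noncomputable def hMat : Alg K n →ₐ[K] Matrix (Fin 2) (Fin 2) (Alg K n) :=
  lift (fun s => !![sgn K m (retr K m (gen K s)), hgen K m s; 0, gen K s])
    (by
      intro i
      simp [hgen, gen_e, ← map_mul, e_mul_self])
    (by
      intro i j h
      ext a b
      fin_cases a <;> fin_cases b <;> simp [hgen, gen_e, ← map_mul, e_mul_e K h])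
    (by
      ext a b
      fin_cases a <;> fin_cases b <;>
        simp [Matrix.sum_apply, hgen, gen_e, ← map_sum, sum_e])
    (by
      intro p i j
      have h := e_mul_of_eMat_mul K (eMat_mul_homotopyMat K m p) i j
      have h' : sgn K m (e K j) = e K j := by
        rw [← gen_e, sgn_gen, deg, sg_zero, one_smul]
      -- As `e_j` is fixed by the sign map and by the retraction, this is the image of the relation
      -- `e_j c^p_{ij} = c^p_{ij}`.
      have h2 : e K j * sgn K m (retr K m (c K p i j)) = sgn K m (retr K m (c K p i j)) := by
        conv_lhs => rw [← h', ← retr_e K m j, ← map_mul, ← map_mul, e_mul_c]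
      simp [hgen, gen_e, gen_c, e_mul_c, retr_e, h, h', h2])
    (by
      intro p i j
      have h := mul_e_of_mul_eMat K (homotopyMat_mul_eMat K m p) i j
      simp [hgen, gen_e, gen_c, ← map_mul, c_mul_e, h])
    (by
      intro i j h
      have h0 : homotopyMat K m 0 j i = 0 := by
        rw [homotopyMat_of_le_one K m zero_le_one, Matrix.zero_apply]
      ext a b
      fin_cases a <;> fin_cases b <;> simp [hgen, gen_c, c_zero K h, h0])

theorem hMat_gen (s : Symbol n) :
    hMat K m (gen K s) = !![sgn K m (retr K m (gen K s)), hgen K m s; 0, gen K s] :=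
  lift_gen _ _ _ _ _ _ _ s

/-- The homotopy between the retraction and the identity. -/
noncomputable def htpy : Alg K n →ₗ[K] Alg K n where
  toFun a := hMat K m a 0 1
  map_add' a b := by simp
  map_smul' x a := by simp

theorem htpy_gen (s : Symbol n) : htpy K m (gen K s) = hgen K m s := by
  change hMat K m (gen K s) 0 1 = _
  rw [hMat_gen]
  rfl

theorem htpy_e (i : Fin n) : htpy K m (e K i) = 0 := htpy_gen K m (.e i)

theorem htpy_c (p : ℕ) (i j : Fin n) : htpy K m (c K p i j) = homotopyMat K m p j i :=
  htpy_gen K m (.c p i j)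

theorem htpy_algebraMap (x : K) : htpy K m (algebraMap K _ x) = 0 := by
  change hMat K m (algebraMap K _ x) 0 1 = 0
  rw [AlgHom.commutes]
  simp [Matrix.algebraMap_matrix_apply]

theorem hMat_eq (a : Alg K n) :
    hMat K m a = !![sgn K m (retr K m a), htpy K m a; 0, a] := by
  induction a using induction_gen with
  | hK x =>
    ext i j
    fin_cases i <;> fin_cases j <;> simp [htpy, Matrix.algebraMap_matrix_apply]
  | hgen s => rw [hMat_gen, htpy_gen]
  | hmul a b ha hb =>
    have h : htpy K m (a * b) = (hMat K m a * hMat K m b) 0 1 := by rw [← map_mul]; rfl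
    rw [h, map_mul, ha, hb]
    ext i j
    fin_cases i <;> fin_cases j <;> simp
  | hadd a b ha hb =>
    rw [map_add, ha, hb]
    ext i j
    fin_cases i <;> fin_cases j <;> simp

theorem htpy_mul (a b : Alg K n) :
    htpy K m (a * b) = htpy K m a * b + sgn K m (retr K m a) * htpy K m b := by
  have h : htpy K m (a * b) = (hMat K m a * hMat K m b) 0 1 := by rw [← map_mul]; rfl
  rw [h, hMat_eq, hMat_eq]
  simp [add_comm]

theorem htpy_gen_mem (s : Symbol n) : htpy K m (gen K s) ∈ gr K m (deg m s - 1) := by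
  rw [htpy_gen]
  cases s with
  | e i => exact Submodule.zero_mem _
  | c p i j =>
    have h := homotopyMat_deg K m p j i
    rw [hgen, deg]
    convert h using 2
    ring

theorem htpy_mem {k : ℤ} {a : Alg K n} (ha : a ∈ gr K m k) : htpy K m a ∈ gr K m (k - 1) := by
  induction ha using Submodule.span_induction with
  | mem x hx =>
    obtain ⟨l, rfl, rfl⟩ := hx
    induction l with
    | nil =>
      have h : htpy K m 1 = 0 := by simpa using htpy_algebraMap K m 1
      simp [h]
    | cons s l ih =>
      simp only [List.map_cons, List.prod_cons, List.sum_cons, htpy_mul]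
      refine Submodule.add_mem _ ?_ ?_
      · have h := mul_mem_gr K m (htpy_gen_mem K m s)
          (Submodule.subset_span ⟨l, rfl, rfl⟩ : (l.map (gen K)).prod ∈ gr K m _)
        convert h using 2
        ring
      · rw [sgn_of_mem K m (retr_gen_mem K m s), smul_mul_assoc]
        refine zsmul_mem ?_ _
        have h := mul_mem_gr K m (retr_gen_mem K m s) ih
        convert h using 2
        ring
  | zero => simp
  | add x y _ _ hx hy => rw [map_add]; exact Submodule.add_mem _ hx hy
  | smul t x _ hx => rw [map_smul]; exact Submodule.smul_mem _ _ hx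

/-- The homotopy has odd degree `-1`. -/
theorem sgn_htpy (a : Alg K n) : sgn K m (htpy K m a) = - htpy K m (sgn K m a) := by
  induction a using induction_gen with
  | hK x => simp [htpy_algebraMap]
  | hgen s =>
    rw [sgn_of_mem K m (htpy_gen_mem K m s), sgn_gen, map_zsmul, sub_eq_add_neg, sg_add]
    simp [sg]
  | hmul a b ha hb =>
    rw [htpy_mul, map_add, map_mul, map_mul, map_mul, htpy_mul, ha, hb, sgn_retr]
    simp only [neg_mul, mul_neg, neg_add]
  | hadd a b ha hb => simp only [map_add, ha, hb, neg_add]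

/-- The homotopy on matrices over the algebra. -/
noncomputable def hMap :
    Matrix (Fin n) (Fin n) (Alg K n) →+ Matrix (Fin n) (Fin n) (Alg K n) :=
  oddMap m (htpy K m).toAddMonoidHom

theorem hMap_mul (A B : Matrix (Fin n) (Fin n) (Alg K n)) :
    hMap K m (A * B) = hMap K m A * B +
      evenMap m ((sgn K m).comp (retr K m) : Alg K n →+ Alg K n) A * hMap K m B :=
  oddMap_mul m (fun a b => htpy_mul K m a b) A B

theorem hMap_cMat (p : ℕ) : hMap K m (cMat K m p) = homotopyMat K m p := by
  ext j i
  change sg (m j) • htpy K m (sg (m j) • c K p i j) = _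
  rw [map_zsmul, sg_smul_smul, htpy_c]

theorem hMap_eMat : hMap K m (eMat K) = 0 := by
  ext j i
  change sg (m j) • htpy K m (Matrix.diagonal (e K) j i) = 0
  by_cases h : j = i
  · subst h
    rw [Matrix.diagonal_apply_eq, htpy_e, smul_zero]
  · rw [Matrix.diagonal_apply_ne _ h, map_zero, smul_zero]

theorem sg_one_sub_two_mul (k : ℕ) : sg (1 - 2 * (k : ℤ)) = -1 := by
  rw [show (1 - 2 * (k : ℤ)) = 1 + (-k + -k) by ring, sg_add, sg_add, sg_mul_self, sg_one, mul_one]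

theorem coeffMap_hMap_cSeries : coeffMap (hMap K m) (cSeries K m) = homotopySeries K m := by
  ext1 p
  rw [coeff_coeffMap, cSeries, PowerSeries.coeff_mk, hMap_cMat, homotopyMat]

/-- The twisted Leibniz rule for `c · c`. The minus sign appears because every coefficient of `r`
has odd degree. -/
theorem coeffMap_hMap_mul_cSeries : coeffMap (hMap K m) (cSeries K m * cSeries K m) =
    homotopySeries K m * cSeries K m - rSeries K m * homotopySeries K m := by
  have h : coeffMap (evenMap m ((sgn K m).comp (retr K m) : Alg K n →+ Alg K n)) (cSeries K m) =
      - rSeries K m := by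
    ext1 p
    rw [coeff_coeffMap, cSeries, PowerSeries.coeff_mk, map_neg, rSeries, PowerSeries.coeff_mk,
      ← map_retr_cMat, ← neg_one_smul ℤ, ← sg_one_sub_two_mul p, map_retr_cMat,
      ← (rMat_deg K m p).evenMap_sgn, ← map_retr_cMat]
    rfl
  rw [coeffMap_mul _ _ (hMap_mul K m), h, coeffMap_hMap_cSeries, neg_mul, ← sub_eq_add_neg]

/-- The Leibniz rule for `v (c - r)`, where all coefficients of `v` have odd degree. -/
theorem coeffMap_dMap_homotopySeries : coeffMap (dMap K m) (homotopySeries K m) =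
    coeffMap (dMap K m) (oddSeries K m homotopyCoeff) * (cSeries K m - rSeries K m) -
      oddSeries K m homotopyCoeff *
        coeffMap (dMap K m) (cSeries K m - rSeries K m) := by
  have h : coeffMap (evenMap m (sgn K m : Alg K n →+ Alg K n)) (oddSeries K m homotopyCoeff) =
      - oddSeries K m homotopyCoeff := by
    ext1 k
    rw [coeff_coeffMap, map_neg, oddSeries, PowerSeries.coeff_mk,
      ((cMat_pow_deg K m (2 * k)).nsmul (homotopyCoeff k)).evenMap_sgn,
      show -(((2 * k : ℕ) : ℤ) + 1) = 1 - 2 * ((k + 1 : ℕ) : ℤ) by push_cast; ring,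
      sg_one_sub_two_mul, neg_one_smul]
  rw [homotopySeries, coeffMap_mul _ _ (dMap_mul K m), h, neg_mul, ← sub_eq_add_neg]

theorem C_eMat_mul_sub : PowerSeries.C (eMat K) * (cSeries K m - rSeries K m) =
    cSeries K m - rSeries K m := by
  ext1 p
  rw [PowerSeries.coeff_C_mul, map_sub, cSeries, rSeries, PowerSeries.coeff_mk,
    PowerSeries.coeff_mk, mul_sub, eMat_mul_cMat, eMat_mul_rMat]

/-- The two orders `v · t w` and `t w · v` agree, which accounts for the factor `2` in the recursion
for `homotopyCoeff`. This is the part of `Dv = E + v r + r v` that does not involve `c^0`. -/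
theorem evenSeries_homotopyCoeff : evenSeries K m homotopyCoeff = PowerSeries.C (eMat K) +
    oddSeries K m homotopyCoeff * (PowerSeries.X * oddSeries K m catalan) +
      PowerSeries.X * oddSeries K m catalan * oddSeries K m homotopyCoeff := by
  have h2 : oddSeries K m (fun k => 2 * homotopyCoeff k) =
      oddSeries K m homotopyCoeff + oddSeries K m homotopyCoeff := by
    ext1 k
    simp only [oddSeries, map_add, PowerSeries.coeff_mk, two_mul, add_smul]
  have hX : oddSeries K m homotopyCoeff * PowerSeries.X =
      PowerSeries.X * oddSeries K m homotopyCoeff := PowerSeries.commute_X _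
  rw [evenSeries_eq K m (b := fun k => 2 * homotopyCoeff k) (f := catalan)
    (by rw [homotopyCoeff]) homotopyCoeff_succ, h2, ← mul_assoc _ PowerSeries.X, hX,
    mul_assoc, mul_assoc, oddSeries_mul_comm K m catalan, add_mul, mul_add, add_assoc]

/-- In `-v (c² - r²) + v (c - r) c - r v (c - r)` the first two terms combine to `-v r (c - r)`. The
left side is thus `(Dv - v r - r v)(c - r)`, which is `E (c - r)` by the choice of `v`. -/
theorem coeffMap_homotopy : coeffMap (dMap K m) (coeffMap (hMap K m) (cSeries K m)) +
    coeffMap (hMap K m) (coeffMap (dMap K m) (cSeries K m)) = cSeries K m - rSeries K m := by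
  have hE : coeffMap (hMap K m) (PowerSeries.X * PowerSeries.C (eMat K)) = 0 := by
    rw [coeffMap_X_mul, coeffMap_C, hMap_eMat, map_zero, mul_zero]
  rw [coeffMap_hMap_cSeries, coeffMap_dMap_cSeries, map_add, hE, zero_add,
    coeffMap_hMap_mul_cSeries, coeffMap_dMap_homotopySeries, map_sub, coeffMap_dMap_cSeries,
    coeffMap_dMap_rSeries, coeffMap_dMap_oddSeries, evenSeries_homotopyCoeff, homotopySeries]
  have hC := C_eMat_mul_sub K m
  have hr := rSeries_eq K m
  -- What remains is an identity in noncommuting variables with `r = x + w`, given that `E` fixes `f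
  -- - r`. Here `w` includes the factor `t`.
  generalize PowerSeries.X * oddSeries K m catalan = w at *
  generalize oddSeries K m homotopyCoeff = v
  generalize PowerSeries.C (cMat K m 0) = x at *
  generalize PowerSeries.C (eMat K) = E at *
  generalize cSeries K m = f at *
  have h : (E + v * w + w * v + x * v + v * x) * (f - rSeries K m) =
      (f - rSeries K m) + (v * rSeries K m + rSeries K m * v) * (f - rSeries K m) := by
    rw [hr] at hC ⊢
    simp only [add_mul, hC]
    noncomm_ring
  rw [h]
  noncomm_ring

theorem dMap_homotopyMat_add (p : ℕ) :
    dMap K m (homotopyMat K m p) + hMap K m (dMap K m (cMat K m p)) =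
      cMat K m p - rMat K m p := by
  have h := congrArg (PowerSeries.coeff p) (coeffMap_homotopy K m)
  simpa only [map_add, map_sub, coeff_coeffMap, cSeries, rSeries, PowerSeries.coeff_mk,
    hMap_cMat] using h

/-- Both sides obey `F(ab) = F(a) b + r(a) F(b)`; for `1 - r` this is the splitting `ab - r(a) r(b)
= (a - r(a)) b + r(a) (b - r(b))`. It therefore suffices to compare them on generators. -/
theorem d_htpy_add_htpy_d (a : Alg K n) :
    d K m (htpy K m a) + htpy K m (d K m a) = a - retr K m a := by
  induction a using induction_gen with
  | hK x => simp [htpy_algebraMap, d_algebraMap]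
  | hgen s =>
    cases s with
    | e i => rw [gen_e, htpy_e, d_e, retr_e, map_zero, map_zero, add_zero, sub_self]
    | c p i j =>
      have h := congrFun (congrFun (dMap_homotopyMat_add K m p) j) i
      change sg (m j) • d K m (homotopyMat K m p j i) +
        sg (m j) • htpy K m (dMap K m (cMat K m p) j i) = sg (m j) • c K p i j - rMat K m p j i at h
      rw [dMap_cMat_apply, ← smul_add] at h
      rw [gen_c, htpy_c, d_c, retr_c, ← sg_smul_smul (m j) (d K m _ + _), h, smul_sub,
        sg_smul_smul]
  | hmul a b ha hb =>
    have h : d K m (htpy K m (a * b)) + htpy K m (d K m (a * b)) =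
        (d K m (htpy K m a) + htpy K m (d K m a)) * b +
          retr K m a * (d K m (htpy K m b) + htpy K m (d K m b)) := by
      -- The mixed terms containing `h(a) d(b)` and `d(r(a)) h(b)` cancel, since the sign map
      -- anticommutes with both `d` and `h`.
      rw [htpy_mul, d_mul, map_add, map_add, d_mul, d_mul, htpy_mul, htpy_mul, sgn_htpy,
        sgn_sgn, sgn_retr K m (sgn K m a), sgn_sgn, retr_d, sgn_d]
      noncomm_ring
    rw [h, ha, hb, map_mul]
    noncomm_ring
  | hadd a b ha hb =>
    simp only [map_add]
    rw [add_sub_add_comm, ← ha, ← hb]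
    abel

end

end Internal

/-! ### From linear maps of degree `-1` to chain homotopies -/

namespace DGAlg

variable {K : Type u} [Field K] {k : Type u} [CommRing k] [Algebra K k]

theorem complex_d (A : DGAlg K k) {i j : ℤ} (h : i + 1 = j) (a : A.gr i) :
    ((A.complex.d i j).hom a : A.gr j).1 = A.d a.1 := by
  simp only [complex, dif_pos h]
  rfl

/-- The morphisms given by a linear map of degree `-1`. -/
noncomputable def lowerHom {A B : DGAlg K k} (h : A.carrier →ₗ[K] B.carrier)
    (h_mem : ∀ {i : ℤ} {a : A.carrier}, a ∈ A.gr i → h a ∈ B.gr (i - 1)) (i j : ℤ) :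
    A.complex.X i ⟶ B.complex.X j :=
  if hij : j + 1 = i then
    ModuleCat.ofHom (h.restrict (p := A.gr i) (q := B.gr j) fun a ha => by
      have h := h_mem ha
      rwa [← hij, add_sub_cancel_right] at h)
  else 0

theorem lowerHom_apply {A B : DGAlg K k} (h : A.carrier →ₗ[K] B.carrier)
    (h_mem : ∀ {i : ℤ} {a : A.carrier}, a ∈ A.gr i → h a ∈ B.gr (i - 1)) {i j : ℤ}
    (hij : j + 1 = i) (a : A.gr i) :
    ((lowerHom h h_mem i j).hom a : B.gr j).1 = h a.1 := by
  exact congrArg (fun f : ModuleCat.of K (A.gr i) ⟶ ModuleCat.of K (B.gr j) => (f.hom a).1)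
    (dif_pos hij : lowerHom h h_mem i j = _)

/-- A linear map `h` of degree `-1` with `d h + h d = f - g` gives a homotopy. -/
noncomputable def Hom.homotopy {A B : DGAlg K k} (f g : Hom A B) (h : A.carrier →ₗ[K] B.carrier)
    (h_mem : ∀ {i : ℤ} {a : A.carrier}, a ∈ A.gr i → h a ∈ B.gr (i - 1))
    (h_comm : ∀ a, B.d (h a) + h (A.d a) = f.toAlgHom a - g.toAlgHom a) :
    Homotopy f.chainMap g.chainMap where
  hom := lowerHom h h_mem
  zero i j hij := dif_neg hij
  comm i := by
    have h1 : (ComplexShape.up ℤ).Rel i (i + 1) := rfl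
    have h2 : (ComplexShape.up ℤ).Rel (i - 1) i := sub_add_cancel i 1
    rw [dNext_eq _ h1, prevD_eq _ h2]
    ext a
    refine Subtype.ext ?_
    have e1 : ((lowerHom h h_mem (i + 1) i).hom ((A.complex.d i (i + 1)).hom a) : B.gr i).1 =
        h (A.d a.1) :=
      (lowerHom_apply h h_mem h1 _).trans (congrArg h (complex_d A h1 a))
    have e2 : ((B.complex.d (i - 1) i).hom ((lowerHom h h_mem i (i - 1)).hom a) : B.gr i).1 =
        B.d (h a.1) :=
      (complex_d B h2 _).trans (congrArg B.d (lowerHom_apply h h_mem h2 a))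
    have e3 := sub_eq_iff_eq_add.1 (h_comm a.1).symm
    rw [add_comm (B.d _), ← e1, ← e2] at e3
    exact e3

end DGAlg

/-! ### The homotopy equivalence and the theorem -/

namespace Internal

variable (K : Type u) [Field K] {n : ℕ} (m : Fin n → ℤ)

/-- The retraction is a homotopy equivalence. -/
noncomputable def retractionHomotopyEquiv :
    HomotopyEquiv (internal K n m).complex (internalSub K n m).complex where
  hom := (retraction K m).chainMap
  inv := (incl K n m).chainMap
  homotopyHomInvId := by
    -- The composite with the inclusion is treated as the endomorphism `r'`. As `dh + hd = 1 - r`,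
    -- the map `htpy` gives a homotopy from the identity to `r'`, hence the final `symm`.
    let id' : DGAlg.Hom (internal K n m) (internal K n m) :=
      ⟨AlgHom.id K _, fun _ => rfl, fun ha => ha, fun _ => rfl⟩
    let r' : DGAlg.Hom (internal K n m) (internal K n m) :=
      ⟨retr K m, retr_unit K m, fun ha => retr_mem K m ha, retr_d K m⟩
    exact (DGAlg.Hom.homotopy id' r' (htpy K m) (fun ha => htpy_mem K m ha)
      (d_htpy_add_htpy_d K m)).symm
  homotopyInvHomId := Homotopy.ofEq (by
    ext i a
    exact Subtype.ext (Subtype.ext (retr_of_mem_subalg K m a.1.2)))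

end Internal

theorem mainTheorem2 (K : Type u) [Field K] (n : ℕ) (m : Fin n → ℤ) :
    ∃ r : DGAlg.Hom (Internal.internal K n m) (Internal.internalSub K n m),
      (∀ a : (Internal.internalSub K n m).carrier,
        r.toAlgHom ((Internal.incl K n m).toAlgHom a) = a) ∧
      (∀ p : ℕ, 1 < p → ∀ i j : Fin n,
        (Internal.incl K n m).toAlgHom (r.toAlgHom (Internal.c K p i j)) =
          (catalan (p - 1) : K) • ∑ k : Fin (2 * p - 2) → Fin n,
            sg (∑ t, m (k t)) • Internal.chain K j i (List.ofFn k)) ∧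
      QuasiIso r.chainMap :=
  ⟨Internal.retraction K m, fun a => Subtype.ext (Internal.retr_of_mem_subalg K m a.2),
    fun _ hp i j => Internal.retr_c_eq K m hp i j,
    (Internal.retractionHomotopyEquiv K m).quasiIso_hom⟩
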